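/- **Setting.** Let $d,M,H,T,b^{(0)}\ge 1$ be integers and $\rho>1$, $L>0$. Participant $m\in\{1,\dots,M\}$ has a finite nonempty data set $\mathcal D_m$, differentiable sample losses $f_m^i:\mathbb R^d\to\mathbb R$ ($i\in\mathcal D_m$), and an integer $1\le k_m\le d$. Put $f_m=\frac1{|\mathcal D_m|}\sum_{i\in\mathcal D_m}f_m^i$, $F=\frac1M\sum_{m=1}^M f_m$, $F^*=\inf F>-\infty$, $\delta_m=d/k_m$ and $\delta=\sqrt{\frac1M\sum_{m=1}^M\delta_m^2}$. For a mini-batch $\mathcal D$, let $\nabla f_m(w;\mathcal D)$ be the gradient at $w$ of the average of the losses $f_m^i$ over the samples in $\mathcal D$. For $x\in\mathbb R^d$, $\mathrm{Top}_k(x)$ keeps the entries of $x$ whose absolute value is at least the $k$-th largest absolute value of the entries of $x$, and replaces all others by $0$. **Algorithm FT-LSGD-DB** (step size $\eta$). Start from a possibly random $w^{(0)}$ with $F(w^{(0)})$ integrable, $\widehat w_m^{(0)}=w^{(0)}$, $e_m^{(0)}=0$. At iteration $t=0,\dots,T-1$, every participant $m$ draws a mini-batch $\mathcal D_m^{(t)}$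 of $b^{(t)}=\lfloor\rho^t b^{(0)}\rfloor$ samples uniformly from $\mathcal D_m$ (with replacement, or without replacement if $b^{(t)}\le|\mathcal D_m|$); all mini-batches and $w^{(0)}$ are independent. It sets $$\widehat w_m^{(t+\frac12)}=\widehat w_m^{(t)}-\eta\,\nabla f_m(\widehat w_m^{(t)};\mathcal D_m^{(t)}).$$ If $H\mid t+1$, then with $u_m^{(t)}=e_m^{(t)}+w^{(t)}-\widehat w_m^{(t+\frac12)}$ and $g_m^{(t)}=\mathrm{Top}_{k_m}(u_m^{(t)})$, put $e_m^{(t+1)}=u_m^{(t)}-g_m^{(t)}$ and $w^{(t+1)}=\widehat w_m^{(t+1)}=w^{(t)}-\frac1M\sum_{j=1}^M g_j^{(t)}$. Otherwise put $\widehat w_m^{(t+1)}=\widehat w_m^{(t+\frac12)}$, $w^{(t+1)}=w^{(t)}$, $e_m^{(t+1)}=e_m^{(t)}$. **Assumptions.** Every $f_m$ is $L$-smooth, i.e. $\|\nabla f_m(w)-\nabla f_m(w')\|\le L\|w-w'\|$ for all $w,w'$. For all $m$ and all $w\in\mathbb R^d$, the gradient of a single uniformly drawn sample has variance $\frac1{|\mathcal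 D_m|}\sum_{i\in\mathcal D_m}\|\nabla f_m^i(w)-\nabla f_m(w)\|^2\le\sigma^2$, and the mini-batch gradients satisfy $\mathbb E\|\nabla f_m(w;\mathcal D_m^{(t)})\|^2\le G^2$ for all $t<T$. **Theorem 1.** Let $\theta>0$ satisfy $\frac{\theta\sqrt M}{\sqrt T}\le\frac1{2L}$, and run the algorithm with the constant step size $\eta=\frac{\theta\sqrt M}{\sqrt T}$. Let $z_T$ be drawn from the local iterates $\widehat w_m^{(t)}$, $0\le t<T$, $1\le m\le M$, each with probability $\frac1{MT}$. Then $\|\nabla F(z_T)\|^2$ is integrable and $$\mathbb E\|\nabla F(z_T)\|^2=\frac1{MT}\sum_{t=0}^{T-1}\sum_{m=1}^M\mathbb E\|\nabla F(\widehat w_m^{(t)})\|^2\le\frac{4\left(\mathbb E[F(w^{(0)})]-F^*\right)}{\theta\sqrt{MT}}+\frac{8\rho\theta L\sigma^2}{(\rho-1)\,b^{(0)}\sqrt M\,T^{3/2}}+(4\delta^2+1)\frac{8M\theta^2L^2G^2H^2}{T}.$$ -/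

import Mathlib

open MeasureTheory ProbabilityTheory

noncomputable section

namespace FTLSGD

/-- The parameter space `ℝ^d` with the Euclidean norm. -/
abbrev Vec (d : ℕ) : Type := EuclideanSpace ℝ (Fin d)

/-- The `k`-th largest absolute value among the entries of `x`, for `1 ≤ k ≤ d`
(`Tuple.sort` lists the absolute values in nondecreasing order at positions `0, …, d - 1`,
so the `k`-th largest stands at position `d - k`). -/
def threshold {d : ℕ} (k : ℕ) (x : Vec d) : ℝ :=
  if h : d - k < d then |x (Tuple.sort (fun i => |x i|) ⟨d - k, h⟩)| else 0

/-- The `Top_k` compressor: keep the entries whose absolute value is at least the `k`-th largest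
absolute value, and set the other entries to zero. -/
def topK {d : ℕ} (k : ℕ) (x : Vec d) : Vec d :=
  WithLp.toLp 2 fun i => if threshold k x ≤ |x i| then x i else 0

/-- The average of finitely many sample losses. For the whole data set of a participant this is
its local loss `f_m`; for a mini-batch it is the mini-batch loss. -/
def avgLoss {d n : ℕ} (l : Fin n → Vec d → ℝ) (w : Vec d) : ℝ :=
  (1 / (n : ℝ)) * ∑ i, l i w

/-- The global objective `F = (1/M) ∑ m, f_m`. -/
def globalLoss {d M : ℕ} {n : Fin M → ℕ} (l : ∀ m, Fin (n m) → Vec d → ℝ) (w : Vec d) : ℝ :=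
  (1 / (M : ℝ)) * ∑ m, avgLoss (l m) w

/-- The gradient at `w` of the loss over the mini-batch that consists of the samples
`B 0, …, B (b - 1)` of the data set. -/
def batchGrad {d n b : ℕ} (l : Fin n → Vec d → ℝ) (w : Vec d) (B : Fin b → Fin n) : Vec d :=
  gradient (avgLoss fun j => l (B j)) w

/-- The mini-batch size `⌊ρ^t b₀⌋` at iteration `t`. -/
def batchSize (ρ : ℝ) (b₀ t : ℕ) : ℕ := ⌊ρ ^ t * (b₀ : ℝ)⌋₊

/-- The variables of the algorithm: the global model `w`, the local models, and the local
accumulated errors. -/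
structure State (d M : ℕ) where
  glob : Vec d
  loc : Fin M → Vec d
  err : Fin M → Vec d

/-- All mini-batches used in a run: `B m t` is the one of participant `m` at iteration `t`. -/
abbrev Batches {M : ℕ} (n : Fin M → ℕ) (ρ : ℝ) (b₀ : ℕ) : Type :=
  ∀ (m : Fin M) (t : ℕ), Fin (batchSize ρ b₀ t) → Fin (n m)

/-- One iteration with step size `η` and mini-batches `B m`: a local gradient step of every
participant, followed, if `sync` holds, by a synchronization with error compensation, `Top_k`
sparsification, error accumulation, averaging at the server and broadcast. -/
def step {d M b : ℕ} {n : Fin M → ℕ} (l : ∀ m, Fin (n m) → Vec d → ℝ) (k : Fin M → ℕ) (η : ℝ)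
    (sync : Prop) [Decidable sync] (B : ∀ m, Fin b → Fin (n m)) (s : State d M) : State d M :=
  let half : Fin M → Vec d := fun m => s.loc m - η • batchGrad (l m) (s.loc m) (B m)
  let g : Fin M → Vec d := fun m => topK (k m) (s.err m + s.glob - half m)
  let w : Vec d := s.glob - (1 / (M : ℝ)) • ∑ m, g m
  if sync then
    { glob := w
      loc := fun _ => w
      err := fun m => s.err m + s.glob - half m - g m }
  else
    { glob := s.glob
      loc := half
      err := s.err }

/-- The state of FT-LSGD-DB before iteration `t`, for sample losses `l`, sparsification parameters
`k m`, synchronization period `H`, step sizes `η t`, initial model `w₀` and mini-batches `B`. All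
local models start at `w₀` and all accumulated errors at zero. -/
def run {d M : ℕ} {n : Fin M → ℕ} {ρ : ℝ} {b₀ : ℕ} (l : ∀ m, Fin (n m) → Vec d → ℝ)
    (k : Fin M → ℕ) (H : ℕ) (η : ℕ → ℝ) (w₀ : Vec d) (B : Batches n ρ b₀) : ℕ → State d M
  | 0 => { glob := w₀, loc := fun _ => w₀, err := fun _ => 0 }
  | t + 1 => step l k (η t) (H ∣ t + 1) (fun m => B m t) (run l k H η w₀ B t)

/-- The random mini-batch `B` of size `b` is sampled uniformly from a data set of size `n`: either
with replacement (all `n ^ b` tuples are equally likely) or without replacement (all tuples of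
distinct samples are equally likely). -/
def IsUniformBatch {Ω : Type*} [MeasurableSpace Ω] (P : Measure Ω) {b n : ℕ}
    (B : Ω → Fin b → Fin n) : Prop :=
  Measurable B ∧
    ((∀ v, P.real (B ⁻¹' {v}) = 1 / (n : ℝ) ^ b) ∨
      (∀ v, (Function.Injective v → P.real (B ⁻¹' {v}) = 1 / (n.descFactorial b : ℝ)) ∧
        (¬ Function.Injective v → P.real (B ⁻¹' {v}) = 0)))

/-- The law of `z_T`, a parameter drawn from the local iterates `W t m` (`t < T`, `m < M`), each
pair `(t, m)` having probability `1 / (M T)`. -/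
def sampledIterateLaw {Ω : Type*} [MeasurableSpace Ω] (P : Measure Ω) {d M : ℕ}
    (W : ℕ → Fin M → Ω → Vec d) (T : ℕ) : Measure (Vec d) :=
  ((M : ENNReal) * (T : ENNReal))⁻¹ • ∑ t ∈ Finset.range T, ∑ m, P.map (W t m)

/-- The root mean square of the sparsities `δ_m = d / k_m`. -/
def rmsSparsity (d : ℕ) {M : ℕ} (k : Fin M → ℕ) : ℝ :=
  √((1 / (M : ℝ)) * ∑ m, ((d : ℝ) / (k m : ℝ)) ^ 2)

end FTLSGD

end

noncomputable section

namespace FTLSGD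

section

/-! ### Smooth functions -/

section Smooth

variable {E : Type*} [NormedAddCommGroup E] [InnerProductSpace ℝ E]

/-! The iterates themselves do not follow a gradient recursion, because `Top_k` discards part of
each update. The virtual iterate, the mean of the local models minus the mean of the accumulated
errors, does: what compression removes from the global model is exactly what enters the errors, so
at every iteration, synchronizing or not, it moves by `-η` times the mean of the mini-batch
gradients (`virtual_step`).

Smoothness then gives expected descent of `F` along the virtual iterates
(`IsSampling.integral_globalLoss_step_le`). Two error terms appear. The sampling noise is unbiased,
has variance at most `σ² / b` for each participant (also without replacement, where distinct draws
are nonpositively correlated), and gains a further factor `1 / M` from independence of the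
participants; since the batch sizes grow geometrically, these variances have a bounded sum. The
other error is the distance from the virtual iterate to the local models at which gradients are
evaluated. It is controlled by the local drift, at most `H` steps of size `η G`, and by the
accumulated error. The latter stays bounded because `Top_k` contracts squared norms by `1 - k / d`,
which makes `2 (d / k) H η G` a self-reproducing bound (`IsSampling.second_moment_bounds`).

Telescoping the descent and using Lipschitz continuity of the gradient to pass from virtual to local
iterates gives the estimate for a fixed initial model
(`IsSampling.sum_integral_norm_gradient_sq_le`). Only finitely many mini-batch outcomes matter
before time `T`, so this part lives on a finite probability space where integrability is automatic.
The random initial model is independent of the batches and is integrated last, by Fubini;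
integrability of `F` at the initial model dominates everything
(`integrable_and_sum_integral_le_of_indepFun`). -/

theorem descent_lemma [CompleteSpace E] {f : E → ℝ} {L : ℝ} (hf : Differentiable ℝ f)
    (hL : ∀ x y, ‖gradient f x - gradient f y‖ ≤ L * ‖x - y‖) (x v : E) :
    f (x + v) ≤ f x + inner ℝ (gradient f x) v + L / 2 * ‖v‖ ^ 2 := by
  -- `f` along the segment minus its quadratic upper model: the Lipschitz bound makes the derivative
  -- nonpositive, and the claim compares `s = 1` with `s = 0`.
  set φ : ℝ → ℝ := fun s =>
    f (x + s • v) - s * inner ℝ (gradient f x) v - L / 2 * s ^ 2 * ‖v‖ ^ 2 with hφ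
  have hder : ∀ s, HasDerivAt φ (inner ℝ (gradient f (x + s • v)) v -
      inner ℝ (gradient f x) v - L * s * ‖v‖ ^ 2) s := by
    intro s
    have hline : HasDerivAt (fun s : ℝ => x + s • v) v s := by
      simpa using ((hasDerivAt_id s).smul_const v).const_add x
    have h1 : HasDerivAt (fun s : ℝ => f (x + s • v)) (inner ℝ (gradient f (x + s • v)) v) s := by
      have h := (hf (x + s • v)).hasFDerivAt.comp_hasDerivAt s hline
      rwa [← inner_gradient_left] at h
    have h2 : HasDerivAt (fun s : ℝ => s * inner ℝ (gradient f x) v)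
        (inner ℝ (gradient f x) v) s := by
      simpa using (hasDerivAt_id s).mul_const (inner ℝ (gradient f x) v)
    have h3 : HasDerivAt (fun s : ℝ => L / 2 * s ^ 2 * ‖v‖ ^ 2) (L * s * ‖v‖ ^ 2) s := by
      have h := ((hasDerivAt_pow 2 s).const_mul (L / 2)).mul_const (‖v‖ ^ 2)
      refine h.congr_deriv ?_
      simp only [Nat.cast_ofNat, Nat.add_one_sub_one, pow_one]
      ring
    exact (h1.sub h2).sub h3
  have hanti : AntitoneOn φ (Set.Icc 0 1) := by
    refine antitoneOn_of_deriv_nonpos (convex_Icc 0 1)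
      (fun s _ => (hder s).continuousAt.continuousWithinAt)
      (fun s _ => (hder s).differentiableAt.differentiableWithinAt) ?_
    intro s hs
    rw [interior_Icc] at hs
    rw [(hder s).deriv, ← inner_sub_left]
    have h1 := real_inner_le_norm (gradient f (x + s • v) - gradient f x) v
    have h2 := hL (x + s • v) x
    rw [add_sub_cancel_left, norm_smul, Real.norm_of_nonneg hs.1.le] at h2
    nlinarith [mul_le_mul_of_nonneg_right h2 (norm_nonneg v)]
  have h := hanti (Set.left_mem_Icc.2 zero_le_one) (Set.right_mem_Icc.2 zero_le_one) zero_le_one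
  simp only [hφ, one_smul, zero_smul, add_zero] at h
  linarith

theorem norm_add_sq_le_two (a b : E) : ‖a + b‖ ^ 2 ≤ 2 * ‖a‖ ^ 2 + 2 * ‖b‖ ^ 2 := by
  have := parallelogram_law_with_norm ℝ a b
  nlinarith [sq_nonneg ‖a - b‖]

theorem norm_avg_sq_le {M : ℕ} (x : Fin M → E) :
    ‖(1 / (M : ℝ)) • ∑ m, x m‖ ^ 2 ≤ (1 / (M : ℝ)) * ∑ m, ‖x m‖ ^ 2 := by
  rcases Nat.eq_zero_or_pos M with rfl | hM
  · simp
  have hM' : (0 : ℝ) < M := by exact_mod_cast hM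
  have h1 : ‖∑ m, x m‖ ^ 2 ≤ M * ∑ m, ‖x m‖ ^ 2 := by
    calc ‖∑ m, x m‖ ^ 2 ≤ (∑ m, ‖x m‖) ^ 2 := by
          gcongr
          exact norm_sum_le _ _
      _ ≤ M * ∑ m, ‖x m‖ ^ 2 := by
          simpa using sq_sum_le_card_mul_sum_sq (s := Finset.univ) (f := fun m => ‖x m‖)
  rw [norm_smul, mul_pow, Real.norm_of_nonneg (by positivity)]
  calc (1 / (M : ℝ)) ^ 2 * ‖∑ m, x m‖ ^ 2 ≤ (1 / (M : ℝ)) ^ 2 * (M * ∑ m, ‖x m‖ ^ 2) := by gcongr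
    _ = _ := by field_simp

/-- The mean minimizes the mean squared distance. Used with `c` the global model, so that the spread
of the local models is bounded by their drift. -/
theorem avg_norm_sub_avg_sq_le {M : ℕ} (hM : 1 ≤ M) (x : Fin M → E) (c : E) :
    (1 / (M : ℝ)) * ∑ m, ‖(1 / (M : ℝ)) • ∑ j, x j - x m‖ ^ 2 ≤
      (1 / (M : ℝ)) * ∑ m, ‖x m - c‖ ^ 2 := by
  have hM' : (0 : ℝ) < M := by exact_mod_cast hM
  set a : E := (1 / (M : ℝ)) • ∑ j, x j with ha
  have hsum : ∑ m, (x m - a) = 0 := by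
    rw [Finset.sum_sub_distrib, Finset.sum_const, Finset.card_univ, Fintype.card_fin, ha,
      ← Nat.cast_smul_eq_nsmul ℝ, smul_smul, mul_one_div_cancel hM'.ne', one_smul, sub_self]
  gcongr ?_ * ?_
  have h1 : ∀ m, ‖x m - c‖ ^ 2 =
      ‖a - x m‖ ^ 2 + 2 * inner ℝ (x m - a) (a - c) + ‖a - c‖ ^ 2 := by
    intro m
    rw [norm_sub_rev a (x m), ← norm_add_sq_real, sub_add_sub_cancel]
  simp_rw [h1]
  rw [Finset.sum_add_distrib, Finset.sum_add_distrib, ← Finset.mul_sum, ← sum_inner, hsum,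
    inner_zero_left]
  have : (0 : ℝ) ≤ ∑ m : Fin M, ‖a - c‖ ^ 2 := by positivity
  linarith

end Smooth

/-! ### Gradients of averages -/

variable {d : ℕ}

theorem hasGradientAt_average {ι : Type*} [Fintype ι] {f : ι → Vec d → ℝ} (c : ℝ)
    (hf : ∀ i, Differentiable ℝ (f i)) (w : Vec d) :
    HasGradientAt (fun w => c * ∑ i, f i w) (c • ∑ i, gradient (f i) w) w := by
  rw [hasGradientAt_iff_hasFDerivAt]
  have h := (HasFDerivAt.fun_sum (u := Finset.univ)
    (fun i _ => (hf i w).hasGradientAt.hasFDerivAt)).const_mul c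
  refine h.congr_fderiv ?_
  simp

theorem hasGradientAt_avgLoss {n : ℕ} {l : Fin n → Vec d → ℝ}
    (hl : ∀ i, Differentiable ℝ (l i)) (w : Vec d) :
    HasGradientAt (avgLoss l) ((1 / (n : ℝ)) • ∑ i, gradient (l i) w) w :=
  hasGradientAt_average _ hl w

theorem differentiable_avgLoss {n : ℕ} {l : Fin n → Vec d → ℝ}
    (hl : ∀ i, Differentiable ℝ (l i)) : Differentiable ℝ (avgLoss l) :=
  fun w => (hasGradientAt_avgLoss hl w).differentiableAt

theorem gradient_avgLoss {n : ℕ} {l : Fin n → Vec d → ℝ}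
    (hl : ∀ i, Differentiable ℝ (l i)) (w : Vec d) :
    gradient (avgLoss l) w = (1 / (n : ℝ)) • ∑ i, gradient (l i) w :=
  (hasGradientAt_avgLoss hl w).gradient

theorem batchGrad_eq {n b : ℕ} {l : Fin n → Vec d → ℝ}
    (hl : ∀ i, Differentiable ℝ (l i)) (w : Vec d) (B : Fin b → Fin n) :
    batchGrad l w B = (1 / (b : ℝ)) • ∑ j, gradient (l (B j)) w :=
  gradient_avgLoss (fun j => hl (B j)) w

theorem hasGradientAt_globalLoss {M : ℕ} {n : Fin M → ℕ} {l : ∀ m, Fin (n m) → Vec d → ℝ}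
    (hl : ∀ m i, Differentiable ℝ (l m i)) (w : Vec d) :
    HasGradientAt (globalLoss l) ((1 / (M : ℝ)) • ∑ m, gradient (avgLoss (l m)) w) w :=
  hasGradientAt_average _ (fun m => differentiable_avgLoss (hl m)) w

theorem differentiable_globalLoss {M : ℕ} {n : Fin M → ℕ} {l : ∀ m, Fin (n m) → Vec d → ℝ}
    (hl : ∀ m i, Differentiable ℝ (l m i)) : Differentiable ℝ (globalLoss l) :=
  fun w => (hasGradientAt_globalLoss hl w).differentiableAt

theorem gradient_globalLoss {M : ℕ} {n : Fin M → ℕ} {l : ∀ m, Fin (n m) → Vec d → ℝ}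
    (hl : ∀ m i, Differentiable ℝ (l m i)) (w : Vec d) :
    gradient (globalLoss l) w = (1 / (M : ℝ)) • ∑ m, gradient (avgLoss (l m)) w :=
  (hasGradientAt_globalLoss hl w).gradient

theorem gradient_globalLoss_lipschitz {M : ℕ} (hM : 1 ≤ M) {n : Fin M → ℕ}
    {l : ∀ m, Fin (n m) → Vec d → ℝ} (hl : ∀ m i, Differentiable ℝ (l m i)) {L : ℝ}
    (hL : ∀ m w w',
      ‖gradient (avgLoss (l m)) w - gradient (avgLoss (l m)) w'‖ ≤ L * ‖w - w'‖) (w w' : Vec d) :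
    ‖gradient (globalLoss l) w - gradient (globalLoss l) w'‖ ≤ L * ‖w - w'‖ := by
  have hM' : (0 : ℝ) < M := by exact_mod_cast hM
  rw [gradient_globalLoss hl, gradient_globalLoss hl, ← smul_sub, ← Finset.sum_sub_distrib,
    norm_smul, Real.norm_of_nonneg (by positivity)]
  calc (1 / (M : ℝ)) * ‖∑ m, (gradient (avgLoss (l m)) w - gradient (avgLoss (l m)) w')‖
      ≤ (1 / (M : ℝ)) * ∑ m : Fin M, L * ‖w - w'‖ := by
        gcongr
        exact norm_sum_le_of_le _ fun m _ => hL m w w'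
    _ = L * ‖w - w'‖ := by
        simp
        field_simp

theorem norm_gradient_globalLoss_sub_avg_sq_le {M : ℕ} {n : Fin M → ℕ}
    {l : ∀ m, Fin (n m) → Vec d → ℝ} (hl : ∀ m i, Differentiable ℝ (l m i)) {L : ℝ}
    (hL : ∀ m w w',
      ‖gradient (avgLoss (l m)) w - gradient (avgLoss (l m)) w'‖ ≤ L * ‖w - w'‖)
    (x : Vec d) (y : Fin M → Vec d) :
    ‖gradient (globalLoss l) x - (1 / (M : ℝ)) • ∑ m, gradient (avgLoss (l m)) (y m)‖ ^ 2 ≤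
      L ^ 2 * ((1 / (M : ℝ)) * ∑ m, ‖x - y m‖ ^ 2) := by
  rw [gradient_globalLoss hl, ← smul_sub, ← Finset.sum_sub_distrib]
  refine (norm_avg_sq_le _).trans ?_
  rw [mul_left_comm, Finset.mul_sum _ _ (L ^ 2)]
  gcongr with m
  rw [← mul_pow]
  exact pow_le_pow_left₀ (norm_nonneg _) (hL m _ _) 2

/-! ### The `Top_k` compressor -/

theorem le_card_threshold_le {k : ℕ} (hk : k ≤ d) (x : Vec d) :
    k ≤ (Finset.univ.filter fun i => threshold k x ≤ |x i|).card := by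
  rcases Nat.eq_zero_or_pos k with rfl | hk0
  · exact Nat.zero_le _
  have h : d - k < d := by omega
  set σ := Tuple.sort fun i => |x i| with hσ
  have hmono : Monotone ((fun i => |x i|) ∘ σ) := Tuple.monotone_sort _
  -- The sorted positions `d - k, …, d - 1` already supply `k` entries; ties at the threshold can
  -- only add more.
  have hsub : (Finset.Ici (⟨d - k, h⟩ : Fin d)).map σ.toEmbedding ⊆
      Finset.univ.filter fun i => threshold k x ≤ |x i| := by
    intro i hi
    obtain ⟨j, hj, rfl⟩ := Finset.mem_map.1 hi
    simpa [threshold, h, ← hσ] using hmono (Finset.mem_Ici.1 hj)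
  have hcard := Finset.card_le_card hsub
  rw [Finset.card_map, Fin.card_Ici] at hcard
  simp only at hcard
  omega

/-- Every kept square is at least `τ ^ 2` and every dropped one at most `τ ^ 2`, so the dropped
squares are on average no larger than the kept ones; and at most `d - k` of the `d` entries are
dropped. -/
theorem norm_sub_topK_sq_le {k : ℕ} (hk1 : 1 ≤ k) (hk : k ≤ d) (x : Vec d) :
    ‖x - topK k x‖ ^ 2 ≤ (1 - (k : ℝ) / d) * ‖x‖ ^ 2 := by
  have hd : (0 : ℝ) < d := by exact_mod_cast (hk1.trans hk)
  set τ := threshold k x with hτ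
  have hτ0 : 0 ≤ τ := by
    rw [hτ, threshold]
    split_ifs
    · exact abs_nonneg _
    · exact le_rfl
  set K := Finset.univ.filter fun i => τ ≤ |x i| with hK
  set S := Finset.univ.filter fun i => ¬ τ ≤ |x i| with hS
  have hcard : (K.card : ℝ) + S.card = d := by
    have := Finset.card_filter_add_card_filter_not (s := (Finset.univ : Finset (Fin d)))
      (fun i => τ ≤ |x i|)
    rw [Finset.card_univ, Fintype.card_fin] at this
    exact_mod_cast this
  have hkK : (k : ℝ) ≤ K.card := by exact_mod_cast le_card_threshold_le hk x
  have h1 : ‖x - topK k x‖ ^ 2 = ∑ i ∈ S, x i ^ 2 := by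
    rw [EuclideanSpace.real_norm_sq_eq, hS, Finset.sum_filter]
    refine Finset.sum_congr rfl fun i _ => ?_
    by_cases h : τ ≤ |x i| <;> simp [topK, ← hτ, h]
  have h2 : ‖x‖ ^ 2 = ∑ i ∈ K, x i ^ 2 + ∑ i ∈ S, x i ^ 2 := by
    rw [EuclideanSpace.real_norm_sq_eq, hK, hS, Finset.sum_filter_add_sum_filter_not]
  have h3 : ∑ i ∈ S, x i ^ 2 ≤ S.card * τ ^ 2 := by
    rw [← nsmul_eq_mul]
    refine Finset.sum_le_card_nsmul _ _ _ fun i hi => ?_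
    rw [← sq_abs]
    exact pow_le_pow_left₀ (abs_nonneg _) (not_le.1 (Finset.mem_filter.1 hi).2).le 2
  have h4 : K.card * τ ^ 2 ≤ ∑ i ∈ K, x i ^ 2 := by
    rw [← nsmul_eq_mul]
    refine Finset.card_nsmul_le_sum _ _ _ fun i hi => ?_
    rw [← sq_abs (x i)]
    exact pow_le_pow_left₀ hτ0 (Finset.mem_filter.1 hi).2 2
  rw [h1, h2]
  set A := ∑ i ∈ K, x i ^ 2
  set C := ∑ i ∈ S, x i ^ 2
  have hA : 0 ≤ A := Finset.sum_nonneg fun i _ => sq_nonneg _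
  have hC : 0 ≤ C := Finset.sum_nonneg fun i _ => sq_nonneg _
  have h5 : (K.card : ℝ) * C ≤ S.card * A := by
    calc (K.card : ℝ) * C ≤ K.card * (S.card * τ ^ 2) := by gcongr
      _ = S.card * (K.card * τ ^ 2) := by ring
      _ ≤ S.card * A := by gcongr
  have h6 : (d : ℝ) * C ≤ (d - k) * (A + C) := by
    have : (S.card : ℝ) * (A + C) ≤ (d - k) * (A + C) := by
      gcongr
      linarith
    nlinarith
  rw [one_sub_div hd.ne', div_mul_eq_mul_div, le_div_iff₀ hd]
  linarith

/-- The sorting permutation takes finitely many values, and each of its level sets is cut out by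
comparisons of the `|x i|` (including the tie-breaking rule), so the threshold is a finite sum of
measurable functions on measurable pieces. -/
theorem measurable_threshold (k : ℕ) : Measurable (threshold (d := d) k) := by
  unfold threshold
  split_ifs with h
  swap
  · exact measurable_const
  have hx : ∀ i, Measurable fun x : Vec d => |x i| := fun i => by fun_prop
  have hset : ∀ σ : Equiv.Perm (Fin d),
      MeasurableSet {x : Vec d | σ = Tuple.sort fun i => |x i|} := by
    intro σ
    simp_rw [Tuple.eq_sort_iff, Monotone, Set.ofPred_and, Set.ofPred_forall]
    refine .inter (.iInter fun i => .iInter fun j => .iInter fun _ =>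
      measurableSet_le (hx _) (hx _)) (.iInter fun i => .iInter fun j => .iInter fun _ => ?_)
    by_cases hlt : σ i < σ j
    · simp [hlt]
    · simp only [hlt, imp_false]
      exact (measurableSet_eq_fun (hx (σ i)) (hx (σ j))).compl
  have heq : (fun x : Vec d => |x (Tuple.sort (fun i => |x i|) ⟨d - k, h⟩)|) =
      fun x => ∑ σ : Equiv.Perm (Fin d),
        {x : Vec d | σ = Tuple.sort fun i => |x i|}.indicator
          (fun x => |x (σ ⟨d - k, h⟩)|) x := by
    funext x
    simp [Set.indicator_apply]
  rw [heq]
  exact Finset.measurable_sum _ fun σ _ => (hx _).indicator (hset σ)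

theorem measurable_topK (k : ℕ) : Measurable (topK (d := d) k) := by
  refine (WithLp.measurable_toLp 2 _).comp (measurable_pi_lambda _ fun i => ?_)
  have hx : Measurable fun x : Vec d => x i := by fun_prop
  exact Measurable.ite (measurableSet_le (measurable_threshold k) hx.abs) hx measurable_const

end

section

/-! ### Expectations of finitely valued random variables -/

section Finite

variable {Ω α β : Type*} [MeasurableSpace Ω] [MeasurableSpace α] [MeasurableSpace β]
  {E : Type*} [NormedAddCommGroup E] [NormedSpace ℝ E]

theorem integral_comp_eq_sum [CompleteSpace E] [Fintype α] [MeasurableSingletonClass α] (P : Measure Ω)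
    [IsFiniteMeasure P] {X : Ω → α} (hX : Measurable X) (φ : α → E) :
    ∫ ω, φ (X ω) ∂P = ∑ x, P.real (X ⁻¹' {x}) • φ x := by
  rw [← integral_map hX.aemeasurable (StronglyMeasurable.of_discrete).aestronglyMeasurable,
    integral_fintype .of_finite]
  refine Finset.sum_congr rfl fun x _ => ?_
  rw [map_measureReal_apply hX (measurableSet_singleton x)]

theorem integral_comp_of_indepFun [Finite α] [MeasurableSingletonClass α] [Finite β]
    [MeasurableSingletonClass β] (P : Measure Ω) [IsProbabilityMeasure P] {X : Ω → α} {Y : Ω → β}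
    (hX : Measurable X) (hY : Measurable Y) (hXY : IndepFun X Y P) (φ : α → β → E) :
    ∫ ω, φ (X ω) (Y ω) ∂P = ∫ ω, ∫ ω', φ (X ω) (Y ω') ∂P ∂P := by
  have h1 : ∫ ω, φ (X ω) (Y ω) ∂P = ∫ z, φ z.1 z.2 ∂(P.map fun ω => (X ω, Y ω)) :=
    (integral_map (f := fun z : α × β => φ z.1 z.2) (hX.prodMk hY).aemeasurable
      (StronglyMeasurable.of_discrete).aestronglyMeasurable).symm
  have : IsProbabilityMeasure (P.map X) := Measure.isProbabilityMeasure_map hX.aemeasurable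
  have : IsProbabilityMeasure (P.map Y) := Measure.isProbabilityMeasure_map hY.aemeasurable
  rw [h1, (indepFun_iff_map_prod_eq_prod_map_map hX.aemeasurable hY.aemeasurable).1 hXY,
    integral_prod _ .of_finite,
    integral_map hX.aemeasurable (StronglyMeasurable.of_discrete).aestronglyMeasurable]
  refine integral_congr_ae (.of_forall fun ω => ?_)
  exact integral_map (f := fun y => φ (X ω) y) hY.aemeasurable
    (StronglyMeasurable.of_discrete).aestronglyMeasurable

end Finite

/-- Minkowski's inequality for second moments. -/
theorem integral_norm_add_sq_le {Ω : Type*} [MeasurableSpace Ω] (P : Measure Ω)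
    {E : Type*} [NormedAddCommGroup E] {f g : Ω → E} {p q : ℝ} (hp : 0 ≤ p) (hq : 0 ≤ q)
    (hf : Integrable (fun ω => ‖f ω‖ ^ 2) P) (hg : Integrable (fun ω => ‖g ω‖ ^ 2) P)
    (hfp : ∫ ω, ‖f ω‖ ^ 2 ∂P ≤ p ^ 2) (hgq : ∫ ω, ‖g ω‖ ^ 2 ∂P ≤ q ^ 2) :
    ∫ ω, ‖f ω + g ω‖ ^ 2 ∂P ≤ (p + q) ^ 2 := by
  -- Young's inequality with weights `b / a` and `a / b` is sharp when the two norms are in the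
  -- ratio `a : b`. The shift by `ε` keeps these weights finite when `p` or `q` is zero.
  have key : ∀ ε : ℝ, 0 < ε → ∫ ω, ‖f ω + g ω‖ ^ 2 ∂P ≤ (p + q + 2 * ε) ^ 2 := by
    intro ε hε
    set a := p + ε with ha
    set b := q + ε with hb
    have ha0 : 0 < a := by positivity
    have hb0 : 0 < b := by positivity
    have hpt : ∀ ω, ‖f ω + g ω‖ ^ 2 ≤ (1 + b / a) * ‖f ω‖ ^ 2 + (1 + a / b) * ‖g ω‖ ^ 2 := by
      intro ω
      have h1 : ‖f ω + g ω‖ ^ 2 ≤ (‖f ω‖ + ‖g ω‖) ^ 2 := by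
        gcongr
        exact norm_add_le _ _
      refine h1.trans ?_
      have h2 : (1 + b / a) * ‖f ω‖ ^ 2 + (1 + a / b) * ‖g ω‖ ^ 2 - (‖f ω‖ + ‖g ω‖) ^ 2 =
          (b * ‖f ω‖ - a * ‖g ω‖) ^ 2 / (a * b) := by
        field_simp
        ring
      have h3 : 0 ≤ (b * ‖f ω‖ - a * ‖g ω‖) ^ 2 / (a * b) := by positivity
      linarith
    calc ∫ ω, ‖f ω + g ω‖ ^ 2 ∂P
        ≤ ∫ ω, ((1 + b / a) * ‖f ω‖ ^ 2 + (1 + a / b) * ‖g ω‖ ^ 2) ∂P :=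
          integral_mono_of_nonneg (.of_forall fun ω => sq_nonneg _)
            ((hf.const_mul _).add (hg.const_mul _)) (.of_forall hpt)
      _ = (1 + b / a) * ∫ ω, ‖f ω‖ ^ 2 ∂P + (1 + a / b) * ∫ ω, ‖g ω‖ ^ 2 ∂P := by
          rw [integral_add (hf.const_mul _) (hg.const_mul _), integral_const_mul,
            integral_const_mul]
      _ ≤ (1 + b / a) * a ^ 2 + (1 + a / b) * b ^ 2 := by
          gcongr
          · exact hfp.trans (pow_le_pow_left₀ hp (by linarith) 2)
          · exact hgq.trans (pow_le_pow_left₀ hq (by linarith) 2)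
      _ = (p + q + 2 * ε) ^ 2 := by
          have : p + q + 2 * ε = a + b := by rw [ha, hb]; ring
          rw [this]
          field_simp
          ring
  have hlim : Filter.Tendsto (fun ε : ℝ => (p + q + 2 * ε) ^ 2) (nhdsWithin 0 (Set.Ioi 0))
      (nhds ((p + q) ^ 2)) := by
    have : Continuous fun ε : ℝ => (p + q + 2 * ε) ^ 2 := by fun_prop
    simpa using (this.tendsto 0).mono_left nhdsWithin_le_nhds
  exact ge_of_tendsto hlim (Filter.eventually_of_mem self_mem_nhdsWithin fun ε hε => key ε hε)

/-! ### Uniform mini-batches -/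

/-- The weights `p` of the mini-batches of a uniform sampling scheme. -/
structure IsBatchWeight {b n : ℕ} (p : (Fin b → Fin n) → ℝ) : Prop where
  nonneg : ∀ v, 0 ≤ p v
  sum_eq_one : ∑ v, p v = 1
  perm : ∀ (σ : Equiv.Perm (Fin n)) v, p (σ ∘ v) = p v
  const_or_injective : (∀ v v', p v = p v') ∨ ∀ v, ¬ Function.Injective v → p v = 0

theorem IsUniformBatch.isBatchWeight {Ω : Type*} [MeasurableSpace Ω] {P : Measure Ω}
    [IsProbabilityMeasure P] {b n : ℕ} {B : Ω → Fin b → Fin n} (h : IsUniformBatch P B) :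
    IsBatchWeight fun v => P.real (B ⁻¹' {v}) where
  nonneg _ := measureReal_nonneg
  sum_eq_one := by
    simpa using (integral_comp_eq_sum P h.1 fun _ => (1 : ℝ)).symm
  perm σ v := by
    rcases h.2 with h | h
    · rw [h, h]
    · by_cases hv : Function.Injective v
      · rw [(h _).1 hv, (h _).1 (σ.injective.comp hv)]
      · rw [(h _).2 hv, (h _).2]
        rwa [σ.injective.of_comp_iff]
  const_or_injective := by
    rcases h.2 with h | h
    · exact .inl fun v v' => by rw [h, h]
    · exact .inr fun v hv => (h v).2 hv

namespace IsBatchWeight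

variable {b n : ℕ} {p : (Fin b → Fin n) → ℝ} {E : Type*} [NormedAddCommGroup E]
  [InnerProductSpace ℝ E]

/-- Each single draw is uniform: relabelling the samples by a transposition preserves the weights,
so the marginal `c` is constant. -/
theorem sum_smul_apply (hp : IsBatchWeight p) (j : Fin b) (g : Fin n → E) :
    ∑ v, p v • g (v j) = (1 / (n : ℝ)) • ∑ i, g i := by
  set c : Fin n → ℝ := fun i => ∑ v, if v j = i then p v else 0 with hc
  have hconst : ∀ i i', c i = c i' := by
    intro i i'
    refine Fintype.sum_equiv ((Equiv.refl _).arrowCongr (Equiv.swap i i')) _ _ fun v => ?_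
    have h1 : (Equiv.refl (Fin b)).arrowCongr (Equiv.swap i i') v = Equiv.swap i i' ∘ v := by
      ext; simp
    simp only [h1, hp.perm, Function.comp_apply, Equiv.swap_apply_eq_iff, Equiv.swap_apply_right]
  have hexp : ∑ v, p v • g (v j) = ∑ i, c i • g i := by
    simp_rw [hc, Finset.sum_smul]
    rw [Finset.sum_comm]
    refine Finset.sum_congr rfl fun v _ => ?_
    simp [ite_smul]
  have hsum : ∑ i, c i = 1 := by
    simp_rw [hc]
    rw [Finset.sum_comm, ← hp.sum_eq_one]
    refine Finset.sum_congr rfl fun v _ => ?_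
    simp
  rw [hexp, Finset.smul_sum]
  refine Finset.sum_congr rfl fun i _ => ?_
  have hci : (n : ℝ) * c i = 1 := by
    rw [← hsum, Finset.sum_congr rfl fun i' _ => hconst i' i]
    simp
  have hn : (n : ℝ) ≠ 0 := left_ne_zero_of_mul_eq_one hci
  congr 1
  field_simp
  linarith

/-- For fixed `i'`, the joint weight `c i i'` of two draws has one common value for all `i ≠ i'`,
and its value at `i = i'` is no larger: equal with replacement, zero without. Since `a` sums to
zero, the common value can be subtracted, leaving a nonpositive multiple of `‖a i'‖ ^ 2`. -/
theorem sum_mul_inner_apply_nonpos (hp : IsBatchWeight p) {j j' : Fin b} (hj : j ≠ j')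
    {a : Fin n → E} (ha : ∑ i, a i = 0) :
    ∑ v, p v * inner ℝ (a (v j)) (a (v j')) ≤ 0 := by
  set c : Fin n → Fin n → ℝ := fun i i' => ∑ v, if v j = i ∧ v j' = i' then p v else 0 with hc
  have hexp : ∑ v, p v * inner ℝ (a (v j)) (a (v j')) =
      ∑ i', ∑ i, c i i' * inner ℝ (a i) (a i') := by
    simp_rw [hc, Finset.sum_mul]
    rw [Finset.sum_congr rfl fun i' _ => Finset.sum_comm, Finset.sum_comm]
    refine Finset.sum_congr rfl fun v _ => ?_
    simp [ite_and, ite_mul]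
  have hoff : ∀ i₀ i i', i₀ ≠ i' → i ≠ i' → c i₀ i' = c i i' := by
    intro i₀ i i' h₀ h
    refine Fintype.sum_equiv ((Equiv.refl _).arrowCongr (Equiv.swap i₀ i)) _ _ fun v => ?_
    have h1 : (Equiv.refl (Fin b)).arrowCongr (Equiv.swap i₀ i) v = Equiv.swap i₀ i ∘ v := by
      ext; simp
    simp only [h1, hp.perm, Function.comp_apply, Equiv.swap_apply_eq_iff, Equiv.swap_apply_right,
      Equiv.swap_apply_of_ne_of_ne h₀.symm h.symm]
  have hdiag : ∀ i i', c i' i' ≤ c i i' := by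
    intro i i'
    rcases hp.const_or_injective with h | h
    -- With constant weights, swapping the labels in the draw `j` alone exchanges the two events and
    -- leaves the draw `j'` untouched.
    · have hinv : Function.Involutive fun v : Fin b → Fin n =>
          Function.update v j (Equiv.swap i' i (v j)) := by
        intro v
        simp
      refine le_of_eq (Fintype.sum_equiv hinv.toPerm _ _ fun v => ?_)
      have h1 : hinv.toPerm _ v = Function.update v j (Equiv.swap i' i (v j)) := rfl
      simp only [h1, Function.update_self, Function.update_of_ne hj.symm, Equiv.swap_apply_eq_iff,
        Equiv.swap_apply_right, h v (Function.update v j (Equiv.swap i' i (v j)))]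
    · have h0 : c i' i' = 0 := by
        refine Finset.sum_eq_zero fun v _ => ?_
        split_ifs with hv
        · exact h v fun hinj => hj (hinj (hv.1.trans hv.2.symm))
        · rfl
      rw [h0]
      refine Finset.sum_nonneg fun v _ => ?_
      split_ifs
      exacts [hp.nonneg v, le_rfl]
  rw [hexp]
  refine Finset.sum_nonpos fun i' _ => ?_
  by_cases hex : ∃ i₀, i₀ ≠ i'
  · obtain ⟨i₀, h₀⟩ := hex
    have h1 : ∑ i, (c i i' - c i₀ i') * inner ℝ (a i) (a i') =
        (c i' i' - c i₀ i') * inner ℝ (a i') (a i') := by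
      refine Finset.sum_eq_single i' (fun i _ hi => ?_) (by simp)
      rw [hoff i₀ i i' h₀ hi, sub_self, zero_mul]
    simp_rw [sub_mul] at h1
    rw [Finset.sum_sub_distrib, ← Finset.mul_sum, ← sum_inner, ha, inner_zero_left, mul_zero,
      sub_zero, ← sub_mul, real_inner_self_eq_norm_sq] at h1
    rw [h1]
    exact mul_nonpos_of_nonpos_of_nonneg (sub_nonpos.2 (hdiag i₀ i')) (sq_nonneg _)
  -- The data set is a single sample, so centring forces `a i' = 0`.
  · push Not at hex
    have h0 : a i' = 0 := by
      rw [← ha]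
      exact (Finset.sum_eq_single i' (fun i _ hi => absurd (hex i) hi) (by simp)).symm
    simp [h0]

theorem sum_mul_norm_avg_sq_le (hp : IsBatchWeight p) {a : Fin n → E} (ha : ∑ i, a i = 0) :
    ∑ v, p v * ‖(1 / (b : ℝ)) • ∑ j, a (v j)‖ ^ 2 ≤
      (1 / (b : ℝ)) * ((1 / (n : ℝ)) * ∑ i, ‖a i‖ ^ 2) := by
  rcases Nat.eq_zero_or_pos b with rfl | hb
  · simp
  have hb' : (0 : ℝ) < b := by exact_mod_cast hb
  set V := (1 / (n : ℝ)) * ∑ i, ‖a i‖ ^ 2 with hV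
  have h1 : ∑ v, p v * ‖∑ j, a (v j)‖ ^ 2 =
      ∑ j, ∑ j', ∑ v, p v * inner ℝ (a (v j)) (a (v j')) := by
    simp_rw [← real_inner_self_eq_norm_sq, sum_inner, inner_sum, Finset.mul_sum]
    rw [Finset.sum_comm]
    refine Finset.sum_congr rfl fun j _ => Finset.sum_comm
  have h2 : ∑ v, p v * ‖∑ j, a (v j)‖ ^ 2 ≤ b * V := by
    calc ∑ v, p v * ‖∑ j, a (v j)‖ ^ 2 ≤ ∑ j : Fin b, ∑ j', if j' = j then V else 0 := by
          rw [h1]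
          refine Finset.sum_le_sum fun j _ => Finset.sum_le_sum fun j' _ => ?_
          split_ifs with h
          · subst h
            have := hp.sum_smul_apply j' fun i => ‖a i‖ ^ 2
            simp only [smul_eq_mul] at this
            simp_rw [real_inner_self_eq_norm_sq, this, hV]
            exact le_rfl
          · exact hp.sum_mul_inner_apply_nonpos (Ne.symm h) ha
      _ = b * V := by simp
  calc ∑ v, p v * ‖(1 / (b : ℝ)) • ∑ j, a (v j)‖ ^ 2
      = (1 / (b : ℝ)) ^ 2 * ∑ v, p v * ‖∑ j, a (v j)‖ ^ 2 := by
        rw [Finset.mul_sum]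
        refine Finset.sum_congr rfl fun v _ => ?_
        rw [norm_smul, mul_pow, Real.norm_of_nonneg (by positivity)]
        ring
    _ ≤ (1 / (b : ℝ)) ^ 2 * (b * V) := by gcongr
    _ = (1 / (b : ℝ)) * V := by field_simp

end IsBatchWeight

/-! ### Mean and variance of the mini-batch gradient -/

section Batch

variable {Ω : Type*} [MeasurableSpace Ω] {P : Measure Ω} [IsProbabilityMeasure P]
  {d b n : ℕ} {B : Ω → Fin b → Fin n} {l : Fin n → Vec d → ℝ}

theorem IsUniformBatch.integral_batchGrad (h : IsUniformBatch P B) (hb : 1 ≤ b)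
    (hl : ∀ i, Differentiable ℝ (l i)) (w : Vec d) :
    ∫ ω, batchGrad l w (B ω) ∂P = gradient (avgLoss l) w := by
  have hb' : (b : ℝ) ≠ 0 := by exact_mod_cast (Nat.one_le_iff_ne_zero.1 hb)
  rw [integral_comp_eq_sum P h.1 (batchGrad l w), gradient_avgLoss hl]
  have hv : ∀ v : Fin b → Fin n, P.real (B ⁻¹' {v}) • batchGrad l w v =
      (1 / (b : ℝ)) • ∑ j, P.real (B ⁻¹' {v}) • gradient (l (v j)) w := by
    intro v
    rw [batchGrad_eq hl, smul_comm, Finset.smul_sum]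
  rw [Finset.sum_congr rfl fun v _ => hv v, ← Finset.smul_sum, Finset.sum_comm,
    Finset.sum_congr rfl fun j _ => h.isBatchWeight.sum_smul_apply j fun i => gradient (l i) w]
  rw [Finset.sum_const, Finset.card_univ, Fintype.card_fin, ← Nat.cast_smul_eq_nsmul ℝ, smul_smul,
    one_div_mul_cancel hb', one_smul]

theorem IsUniformBatch.integral_norm_batchGrad_sub_sq_le (h : IsUniformBatch P B) (hb : 1 ≤ b)
    (hn : 1 ≤ n) (hl : ∀ i, Differentiable ℝ (l i)) (w : Vec d) :
    ∫ ω, ‖batchGrad l w (B ω) - gradient (avgLoss l) w‖ ^ 2 ∂P ≤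
      (1 / (b : ℝ)) *
        ((1 / (n : ℝ)) * ∑ i, ‖gradient (l i) w - gradient (avgLoss l) w‖ ^ 2) := by
  have hb' : (b : ℝ) ≠ 0 := by exact_mod_cast (Nat.one_le_iff_ne_zero.1 hb)
  have hn' : (n : ℝ) ≠ 0 := by exact_mod_cast (Nat.one_le_iff_ne_zero.1 hn)
  set a : Fin n → Vec d := fun i => gradient (l i) w - gradient (avgLoss l) w with ha
  have hsum : ∑ i, a i = 0 := by
    rw [ha, Finset.sum_sub_distrib, Finset.sum_const, Finset.card_univ, Fintype.card_fin,
      gradient_avgLoss hl, ← Nat.cast_smul_eq_nsmul ℝ, smul_smul, mul_one_div_cancel hn', one_smul,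
      sub_self]
  have hv : ∀ v : Fin b → Fin n, batchGrad l w v - gradient (avgLoss l) w =
      (1 / (b : ℝ)) • ∑ j, a (v j) := by
    intro v
    rw [ha, Finset.sum_sub_distrib, Finset.sum_const, Finset.card_univ, Fintype.card_fin,
      batchGrad_eq hl, smul_sub, ← Nat.cast_smul_eq_nsmul ℝ, smul_smul, one_div_mul_cancel hb',
      one_smul]
  rw [integral_comp_eq_sum P h.1 fun v => ‖batchGrad l w v - gradient (avgLoss l) w‖ ^ 2]
  simp_rw [hv]
  exact h.isBatchWeight.sum_mul_norm_avg_sq_le hsum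

end Batch

/-! ### Growing batch sizes -/

theorem one_le_pow_mul {ρ : ℝ} (hρ : 1 < ρ) {b₀ : ℕ} (hb₀ : 1 ≤ b₀) (t : ℕ) :
    1 ≤ ρ ^ t * (b₀ : ℝ) :=
  one_le_mul_of_one_le_of_one_le (one_le_pow₀ hρ.le) (by exact_mod_cast hb₀)

theorem one_le_batchSize {ρ : ℝ} (hρ : 1 < ρ) {b₀ : ℕ} (hb₀ : 1 ≤ b₀) (t : ℕ) :
    1 ≤ batchSize ρ b₀ t :=
  Nat.le_floor (by simpa using one_le_pow_mul hρ hb₀ t)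

theorem sum_inv_batchSize_le {ρ : ℝ} (hρ : 1 < ρ) {b₀ : ℕ} (hb₀ : 1 ≤ b₀) (T : ℕ) :
    ∑ t ∈ Finset.range T, 1 / (batchSize ρ b₀ t : ℝ) ≤ 2 * ρ / ((ρ - 1) * b₀) := by
  have hb : (0 : ℝ) < b₀ := by exact_mod_cast hb₀
  have hρ0 : 0 < ρ := by linarith
  have hρ1 : 0 < ρ - 1 := by linarith
  have h1 : ∀ t, 1 / (batchSize ρ b₀ t : ℝ) ≤ 2 / b₀ * (ρ⁻¹) ^ t := by
    intro t
    have hx := one_le_pow_mul hρ hb₀ t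
    have hfl := Nat.lt_floor_add_one (ρ ^ t * (b₀ : ℝ))
    have hone : (1 : ℝ) ≤ batchSize ρ b₀ t := by exact_mod_cast one_le_batchSize hρ hb₀ t
    -- Rounding down a number that is at least `1` loses at most a factor `2`.
    have h2 : ρ ^ t * b₀ / 2 ≤ batchSize ρ b₀ t := by
      unfold batchSize at hone ⊢
      linarith
    calc 1 / (batchSize ρ b₀ t : ℝ) ≤ 1 / (ρ ^ t * b₀ / 2) :=
          one_div_le_one_div_of_le (by positivity) h2
      _ = 2 / b₀ * (ρ⁻¹) ^ t := by
          rw [inv_pow]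
          field_simp
  have hgeom : ∑ t ∈ Finset.range T, (ρ⁻¹) ^ t ≤ ρ / (ρ - 1) := by
    have h := (summable_geometric_of_lt_one (inv_nonneg.2 hρ0.le)
      (inv_lt_one_of_one_lt₀ hρ)).sum_le_tsum (Finset.range T) fun t _ => by positivity
    rw [tsum_geometric_of_lt_one (inv_nonneg.2 hρ0.le) (inv_lt_one_of_one_lt₀ hρ)] at h
    refine h.trans (le_of_eq ?_)
    field_simp
  calc ∑ t ∈ Finset.range T, 1 / (batchSize ρ b₀ t : ℝ)
      ≤ ∑ t ∈ Finset.range T, 2 / b₀ * (ρ⁻¹) ^ t := Finset.sum_le_sum fun t _ => h1 t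
    _ = 2 / b₀ * ∑ t ∈ Finset.range T, (ρ⁻¹) ^ t := by rw [Finset.mul_sum]
    _ ≤ 2 / b₀ * (ρ / (ρ - 1)) := by gcongr
    _ = 2 * ρ / ((ρ - 1) * b₀) := by field_simp

end

section

/-! ### The virtual iterates -/

variable {d M : ℕ} {n : Fin M → ℕ}

/-- The average of the local models, corrected by the average of the accumulated errors. -/
def State.virtual (s : State d M) : Vec d :=
  (1 / (M : ℝ)) • ∑ m, s.loc m - (1 / (M : ℝ)) • ∑ m, s.err m

theorem avg_const {E : Type*} [AddCommGroup E] [Module ℝ E] (hM : 1 ≤ M) (c : E) :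
    (1 / (M : ℝ)) • ∑ _m : Fin M, c = c := by
  have hM' : (M : ℝ) ≠ 0 := by exact_mod_cast (Nat.one_le_iff_ne_zero.1 hM)
  rw [Finset.sum_const, Finset.card_univ, Fintype.card_fin, ← Nat.cast_smul_eq_nsmul ℝ, smul_smul,
    one_div_mul_cancel hM', one_smul]

/-- At a synchronization the transmitted part `g` cancels between the new global model and the new
errors, leaving the mean of the half-step models minus the mean of the old errors, just as in a
purely local iteration. -/
theorem virtual_step (hM : 1 ≤ M) {b : ℕ} (l : ∀ m, Fin (n m) → Vec d → ℝ) (k : Fin M → ℕ)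
    (η : ℝ) (sync : Prop) [Decidable sync] (B : ∀ m, Fin b → Fin (n m)) (s : State d M) :
    (step l k η sync B s).virtual =
      s.virtual - η • ((1 / (M : ℝ)) • ∑ m, batchGrad (l m) (s.loc m) (B m)) := by
  unfold step State.virtual
  split_ifs
  · simp only [avg_const hM, Finset.sum_sub_distrib, Finset.sum_add_distrib, smul_sub, smul_add,
      ← Finset.smul_sum, smul_comm _ η]
    abel
  · simp only [Finset.sum_sub_distrib, smul_sub, ← Finset.smul_sum, smul_comm _ η]
    abel

theorem avg_norm_virtual_sub_loc_sq_le (hM : 1 ≤ M) (s : State d M) :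
    (1 / (M : ℝ)) * ∑ m, ‖s.virtual - s.loc m‖ ^ 2 ≤
      2 * ((1 / (M : ℝ)) * ∑ m, ‖s.loc m - s.glob‖ ^ 2) +
        2 * ((1 / (M : ℝ)) * ∑ m, ‖s.err m‖ ^ 2) := by
  set a := (1 / (M : ℝ)) • ∑ m, s.loc m
  set e := (1 / (M : ℝ)) • ∑ m, s.err m
  have h1 : ∀ m, ‖s.virtual - s.loc m‖ ^ 2 ≤ 2 * ‖a - s.loc m‖ ^ 2 + 2 * ‖e‖ ^ 2 := by
    intro m
    have h := norm_add_sq_le_two (a - s.loc m) (-e)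
    have hvirt : s.virtual - s.loc m = a - s.loc m + -e := by
      change a - e - s.loc m = _
      abel
    rwa [norm_neg, ← hvirt] at h
  have h2 := avg_norm_sub_avg_sq_le hM s.loc s.glob
  have h3 := norm_avg_sq_le s.err
  have h4 : (1 / (M : ℝ)) * ∑ _m : Fin M, 2 * ‖e‖ ^ 2 = 2 * ‖e‖ ^ 2 := avg_const hM (2 * ‖e‖ ^ 2)
  calc (1 / (M : ℝ)) * ∑ m, ‖s.virtual - s.loc m‖ ^ 2
      ≤ (1 / (M : ℝ)) * ∑ m, (2 * ‖a - s.loc m‖ ^ 2 + 2 * ‖e‖ ^ 2) := by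
        gcongr with m
        exact h1 m
    _ = 2 * ((1 / (M : ℝ)) * ∑ m, ‖a - s.loc m‖ ^ 2) + 2 * ‖e‖ ^ 2 := by
        rw [Finset.sum_add_distrib, mul_add, h4, ← Finset.mul_sum]
        ring
    _ ≤ _ := by gcongr

theorem run_congr {ρ : ℝ} {b₀ : ℕ} (l : ∀ m, Fin (n m) → Vec d → ℝ) (k : Fin M → ℕ) (H : ℕ)
    (η : ℕ → ℝ) (w : Vec d) {B B' : Batches n ρ b₀} :
    ∀ t, (∀ m, ∀ s < t, B m s = B' m s) → run l k H η w B t = run l k H η w B' t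
  | 0, _ => rfl
  | t + 1, h => by
    have h1 : (fun m => B m t) = fun m => B' m t := funext fun m => h m t t.lt_succ_self
    simp only [run]
    rw [run_congr l k H η w t fun m s hs => h m s (hs.trans t.lt_succ_self), h1]

/-! ### Independence of the state and the next mini-batches -/

/-- Independent uniform mini-batches up to time `T`. -/
structure IsSampling {Ω : Type*} [MeasurableSpace Ω] (P : Measure Ω) {ρ : ℝ} {b₀ : ℕ} (T : ℕ)
    (B : Ω → Batches n ρ b₀) : Prop where
  unif : ∀ m, ∀ t < T, IsUniformBatch P fun ω => B ω m t
  indep : iIndepFun (fun (p : Fin M × Fin T) ω => B ω p.1 (p.2 : ℕ)) P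

section Core

variable {Ω : Type*} [MeasurableSpace Ω] [Finite Ω] [MeasurableSingletonClass Ω] {P : Measure Ω}
  [IsProbabilityMeasure P] {ρ : ℝ} {b₀ T : ℕ} {B : Ω → Batches n ρ b₀}
  {l : ∀ m, Fin (n m) → Vec d → ℝ}

/-- The state before iteration `t` is a function of the earlier mini-batches, which are independent
of those at time `t`. The current batches may therefore be replaced by an independent copy; this
plays the role of conditioning on the past. -/
theorem IsSampling.integral_run_batch (hB : IsSampling P T B) (k : Fin M → ℕ) (H : ℕ)
    (η : ℕ → ℝ) (w : Vec d) {t : ℕ} (ht : t < T) {E : Type*} [NormedAddCommGroup E]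
    [NormedSpace ℝ E]
    (φ : State d M → (∀ m, Fin (batchSize ρ b₀ t) → Fin (n m)) → E) :
    ∫ ω, φ (run l k H η w (B ω) t) (fun m => B ω m t) ∂P =
      ∫ ω, ∫ ω', φ (run l k H η w (B ω) t) (fun m => B ω' m t) ∂P ∂P := by
  set past : Finset (Fin M × Fin T) := Finset.univ.filter fun p => (p.2 : ℕ) < t with hpast
  set now : Finset (Fin M × Fin T) := Finset.univ.filter fun p => (p.2 : ℕ) = t with hnow
  have hdisj : Disjoint past now := by
    rw [Finset.disjoint_left]
    intro p hp hp'
    exact (Finset.mem_filter.1 hp).2.ne (Finset.mem_filter.1 hp').2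
  have hind := hB.indep.indepFun_finset past now hdisj fun p => .of_discrete
  set U : Ω → ∀ p : past, Fin (batchSize ρ b₀ p.1.2) → Fin (n p.1.1) :=
    fun ω p => B ω p.1.1 p.1.2 with hU
  have hmem : ∀ m, (m, (⟨t, ht⟩ : Fin T)) ∈ now := fun m => by simp [hnow]
  have hind' : IndepFun U (fun ω m => B ω m t) P :=
    hind.comp (φ := id) (ψ := fun (y : ∀ p : now, Fin (batchSize ρ b₀ p.1.2) → Fin (n p.1.1)) m =>
      y ⟨(m, ⟨t, ht⟩), hmem m⟩) measurable_id .of_discrete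
  have hfac : (fun ω => run l k H η w (B ω) t).FactorsThrough U := by
    intro ω ω' h
    refine run_congr l k H η w t fun m s hs => ?_
    exact congrFun h ⟨(m, ⟨s, hs.trans ht⟩), by simp [hpast, hs]⟩
  have : Nonempty (State d M) := ⟨⟨0, fun _ => 0, fun _ => 0⟩⟩
  obtain ⟨Φ, hΦ⟩ := (Function.factorsThrough_iff _).1 hfac
  have hΦ' : ∀ ω, run l k H η w (B ω) t = Φ (U ω) := congrFun hΦ
  simp_rw [hΦ']
  exact integral_comp_of_indepFun P (X := U) .of_discrete .of_discrete hind' fun u y => φ (Φ u) y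

/-! ### Second moments of the local drift and of the accumulated error -/

theorem IsSampling.integral_norm_batchGrad_run_sq_le (hB : IsSampling P T B) {G : ℝ}
    (hmom : ∀ m, ∀ t < T, ∀ w, ∫ ω, ‖batchGrad (l m) w (B ω m t)‖ ^ 2 ∂P ≤ G ^ 2)
    (k : Fin M → ℕ) (H : ℕ) (η : ℕ → ℝ) (w : Vec d) {t : ℕ} (ht : t < T) (m : Fin M) :
    ∫ ω, ‖batchGrad (l m) ((run l k H η w (B ω) t).loc m) (B ω m t)‖ ^ 2 ∂P ≤ G ^ 2 := by
  -- The moment bound is assumed at deterministic points only; freezing the state makes it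
  -- applicable at the random local model.
  rw [hB.integral_run_batch k H η w ht fun s v => ‖batchGrad (l m) (s.loc m) (v m)‖ ^ 2]
  calc _ ≤ ∫ _ω, G ^ 2 ∂P :=
        integral_mono .of_finite .of_finite fun ω => hmom m t ht _
    _ = G ^ 2 := by simp

/-- With `γ = k / d`, this closes the induction for the accumulated error: in units of `H η G`, an
error of size `2 / γ` plus one period of drift is compressed back to size at most `2 / γ`. -/
theorem compression_bound {γ : ℝ} (h0 : 0 < γ) :
    (1 - γ) * (2 * γ⁻¹ + 1) ^ 2 ≤ (2 * γ⁻¹) ^ 2 := by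
  have h : (2 * γ⁻¹) ^ 2 - (1 - γ) * (2 * γ⁻¹ + 1) ^ 2 = 3 + γ := by
    field_simp
    ring
  linarith

theorem succ_mod_of_not_dvd {H t : ℕ} (hH : 1 ≤ H) (h : ¬ H ∣ t + 1) : (t + 1) % H = t % H + 1 := by
  have h1 : t % H < H := Nat.mod_lt _ hH
  have h2 : t % H + 1 ≠ H := by
    intro h2
    refine h ⟨t / H + 1, ?_⟩
    have := Nat.mod_add_div t H
    rw [mul_add]
    omega
  rw [Nat.add_mod, Nat.mod_eq_of_lt (a := t % H + 1 % H)] <;>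
    rw [Nat.mod_eq_of_lt (show 1 < H by omega)]
  omega

/-- Before iteration `t` a local model has made `t % H` steps since the last synchronization, each
of root mean square size at most `η |G|`. The accumulated error changes only at synchronizations,
where the contraction of `topK` preserves its bound. -/
theorem IsSampling.second_moment_bounds (hB : IsSampling P T B) {G : ℝ}
    (hmom : ∀ m, ∀ t < T, ∀ w, ∫ ω, ‖batchGrad (l m) w (B ω m t)‖ ^ 2 ∂P ≤ G ^ 2)
    {k : Fin M → ℕ} (hk : ∀ m, 1 ≤ k m ∧ k m ≤ d) {H : ℕ} (hH : 1 ≤ H) {η : ℝ} (hη : 0 ≤ η)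
    (w : Vec d) (m : Fin M) : ∀ t ≤ T,
      ∫ ω, ‖(run l k H (fun _ => η) w (B ω) t).loc m -
        (run l k H (fun _ => η) w (B ω) t).glob‖ ^ 2 ∂P ≤ ((t % H : ℕ) * (η * |G|)) ^ 2 ∧
      ∫ ω, ‖(run l k H (fun _ => η) w (B ω) t).err m‖ ^ 2 ∂P ≤
        (2 * ((d : ℝ) / k m) * (H * (η * |G|))) ^ 2
  | 0, _ => by
    simp only [run, sub_self, norm_zero]
    exact ⟨by simp, by simp; positivity⟩
  | t + 1, ht => by
    obtain ⟨ih1, ih2⟩ := hB.second_moment_bounds hmom hk hH hη w m t (by omega)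
    have hg := hB.integral_norm_batchGrad_run_sq_le hmom k H (fun _ => η) w
      (show t < T by omega) m
    set S : Ω → State d M := fun ω => run l k H (fun _ => η) w (B ω) t
    set g : Ω → Vec d := fun ω => batchGrad (l m) ((S ω).loc m) (B ω m t)
    have hK : 0 ≤ η * |G| := by positivity
    have hηg : ∫ ω, ‖-(η • g ω)‖ ^ 2 ∂P ≤ (η * |G|) ^ 2 := by
      simp_rw [norm_neg, norm_smul, mul_pow, integral_const_mul, sq_abs, Real.norm_eq_abs, sq_abs]
      exact mul_le_mul_of_nonneg_left hg (sq_nonneg _)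
    have hdrift := integral_norm_add_sq_le P (f := fun ω => (S ω).loc m - (S ω).glob)
      (g := fun ω => -(η • g ω)) (by positivity) hK .of_finite .of_finite ih1 hηg
    have hrun : ∀ ω, run l k H (fun _ => η) w (B ω) (t + 1) =
        step l k η (H ∣ t + 1) (fun m => B ω m t) (S ω) := fun ω => rfl
    simp only [hrun, step]
    by_cases hs : H ∣ t + 1
    · simp only [if_pos hs, sub_self, norm_zero]
      refine ⟨by simp; positivity, ?_⟩
      have hd : (0 : ℝ) < d := by exact_mod_cast (hk m).1.trans (hk m).2
      have hkm : (0 : ℝ) < k m := by exact_mod_cast (hk m).1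
      have hkd : (k m : ℝ) / d ≤ 1 := by
        rw [div_le_one hd]
        exact_mod_cast (hk m).2
      have hmod : ((t % H : ℕ) : ℝ) + 1 ≤ H := by exact_mod_cast Nat.mod_lt t hH
      -- The vector fed to the compressor is the old error minus the drift of a full period; the
      -- drift has at most `t % H + 1 ≤ H` steps.
      set u : Ω → Vec d := fun ω => (S ω).err m + (S ω).glob - ((S ω).loc m - η • g ω) with hu
      have hu_le : ∫ ω, ‖u ω‖ ^ 2 ∂P ≤
          ((2 * ((d : ℝ) / k m) + 1) * (H * (η * |G|))) ^ 2 := by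
        have h := integral_norm_add_sq_le P (f := fun ω => (S ω).err m)
          (g := fun ω => -((S ω).loc m - (S ω).glob + -(η • g ω)))
          (q := (t % H : ℕ) * (η * |G|) + η * |G|) (by positivity) (by positivity) .of_finite .of_finite ih2 (by simpa only [norm_neg] using hdrift)
        have heq : ∀ ω, (S ω).err m + -((S ω).loc m - (S ω).glob + -(η • g ω)) = u ω := by
          intro ω
          simp only [hu]
          abel
        simp only [heq] at h
        refine h.trans (pow_le_pow_left₀ (by positivity) ?_ 2)
        have : ((t % H : ℕ) + 1) * (η * |G|) ≤ H * (η * |G|) := by gcongr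
        linarith
      calc ∫ ω, ‖u ω - topK (k m) (u ω)‖ ^ 2 ∂P
          ≤ ∫ ω, (1 - (k m : ℝ) / d) * ‖u ω‖ ^ 2 ∂P :=
            integral_mono .of_finite .of_finite fun ω =>
              norm_sub_topK_sq_le (hk m).1 (hk m).2 (u ω)
        _ ≤ (1 - (k m : ℝ) / d) * ((2 * ((d : ℝ) / k m) + 1) * (H * (η * |G|))) ^ 2 := by
            rw [integral_const_mul]
            exact mul_le_mul_of_nonneg_left hu_le (by linarith)
        _ ≤ (2 * ((d : ℝ) / k m) * (H * (η * |G|))) ^ 2 := by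
            rw [mul_pow _ (H * (η * |G|)), mul_pow _ (H * (η * |G|)), ← mul_assoc]
            have h := compression_bound (div_pos hkm hd)
            rw [inv_div] at h
            gcongr
    · simp only [if_neg hs]
      refine ⟨?_, ih2⟩
      rw [succ_mod_of_not_dvd hH hs]
      refine le_trans (le_of_eq ?_) (hdrift.trans (le_of_eq ?_))
      · refine integral_congr_ae (.of_forall fun ω => ?_)
        simp only [g]
        congr 2
        abel
      · push_cast
        ring

theorem IsSampling.integral_avg_norm_virtual_sub_loc_sq_le (hB : IsSampling P T B) {G : ℝ}
    (hmom : ∀ m, ∀ t < T, ∀ w, ∫ ω, ‖batchGrad (l m) w (B ω m t)‖ ^ 2 ∂P ≤ G ^ 2)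
    (hM : 1 ≤ M) {k : Fin M → ℕ} (hk : ∀ m, 1 ≤ k m ∧ k m ≤ d) {H : ℕ} (hH : 1 ≤ H) {η : ℝ}
    (hη : 0 ≤ η) (w : Vec d) {t : ℕ} (ht : t ≤ T) :
    ∫ ω, (1 / (M : ℝ)) * ∑ m, ‖(run l k H (fun _ => η) w (B ω) t).virtual -
        (run l k H (fun _ => η) w (B ω) t).loc m‖ ^ 2 ∂P ≤
      2 * (4 * rmsSparsity d k ^ 2 + 1) * (η ^ 2 * G ^ 2 * H ^ 2) := by
  set S : Ω → State d M := fun ω => run l k H (fun _ => η) w (B ω) t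
  have hb := fun m => hB.second_moment_bounds hmom hk hH hη w m t ht
  have hmod : ((t % H : ℕ) : ℝ) ≤ H := by exact_mod_cast (Nat.mod_lt t hH).le
  have h1 : ∀ m, ∫ ω, ‖(S ω).loc m - (S ω).glob‖ ^ 2 ∂P ≤ η ^ 2 * G ^ 2 * H ^ 2 := by
    intro m
    refine (hb m).1.trans ?_
    rw [mul_pow, mul_pow, sq_abs, mul_comm (_ ^ 2 : ℝ)]
    gcongr
  have h2 : ∀ m, ∫ ω, ‖(S ω).err m‖ ^ 2 ∂P ≤
      4 * (η ^ 2 * G ^ 2 * H ^ 2) * ((d : ℝ) / k m) ^ 2 := by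
    intro m
    refine (hb m).2.trans (le_of_eq ?_)
    rw [mul_pow, mul_pow, mul_pow, mul_pow, sq_abs]
    ring
  have hrms : rmsSparsity d k ^ 2 = (1 / (M : ℝ)) * ∑ m, ((d : ℝ) / (k m : ℝ)) ^ 2 :=
    Real.sq_sqrt (by positivity)
  calc _ ≤ ∫ ω, (2 * ((1 / (M : ℝ)) * ∑ m, ‖(S ω).loc m - (S ω).glob‖ ^ 2) +
          2 * ((1 / (M : ℝ)) * ∑ m, ‖(S ω).err m‖ ^ 2)) ∂P :=
        integral_mono .of_finite .of_finite fun ω => avg_norm_virtual_sub_loc_sq_le hM (S ω)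
    _ = 2 * ((1 / (M : ℝ)) * ∑ m, ∫ ω, ‖(S ω).loc m - (S ω).glob‖ ^ 2 ∂P) +
          2 * ((1 / (M : ℝ)) * ∑ m, ∫ ω, ‖(S ω).err m‖ ^ 2 ∂P) := by
        rw [integral_add .of_finite .of_finite]
        simp_rw [integral_const_mul]
        rw [integral_finsetSum _ fun _ _ => .of_finite, integral_finsetSum _ fun _ _ => .of_finite]
    _ ≤ 2 * ((1 / (M : ℝ)) * ∑ m : Fin M, η ^ 2 * G ^ 2 * H ^ 2) +
          2 * ((1 / (M : ℝ)) * ∑ m, 4 * (η ^ 2 * G ^ 2 * H ^ 2) * ((d : ℝ) / k m) ^ 2) := by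
        gcongr with m _ m _
        · exact h1 m
        · exact h2 m
    _ = _ := by
        have := avg_const hM (η ^ 2 * G ^ 2 * (H : ℝ) ^ 2)
        rw [smul_eq_mul] at this
        rw [this, hrms, ← Finset.mul_sum]
        ring

/-! ### Expected descent -/

theorem integral_norm_avg_sq_le_of_uncorrelated {E : Type*} [NormedAddCommGroup E]
    [InnerProductSpace ℝ E] (hM : 1 ≤ M) {ξ : Fin M → Ω → E} {v : ℝ}
    (hcov : ∀ i j, i ≠ j → ∫ ω, inner ℝ (ξ i ω) (ξ j ω) ∂P = 0)
    (hv : ∀ i, ∫ ω, ‖ξ i ω‖ ^ 2 ∂P ≤ v) :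
    ∫ ω, ‖(1 / (M : ℝ)) • ∑ m, ξ m ω‖ ^ 2 ∂P ≤ v / M := by
  have hM' : (0 : ℝ) < M := by exact_mod_cast hM
  have h1 : ∫ ω, ‖∑ m, ξ m ω‖ ^ 2 ∂P = ∑ i, ∑ j, ∫ ω, inner ℝ (ξ i ω) (ξ j ω) ∂P := by
    simp_rw [← real_inner_self_eq_norm_sq, sum_inner, inner_sum]
    rw [integral_finsetSum _ fun _ _ => .of_finite]
    exact Finset.sum_congr rfl fun i _ => integral_finsetSum _ fun _ _ => .of_finite
  have h2 : ∫ ω, ‖∑ m, ξ m ω‖ ^ 2 ∂P ≤ M * v := by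
    calc ∫ ω, ‖∑ m, ξ m ω‖ ^ 2 ∂P ≤ ∑ i : Fin M, ∑ j, if j = i then v else 0 := by
          rw [h1]
          refine Finset.sum_le_sum fun i _ => Finset.sum_le_sum fun j _ => ?_
          split_ifs with h
          · subst h
            simpa only [real_inner_self_eq_norm_sq] using hv j
          · exact (hcov i j (Ne.symm h)).le
      _ = M * v := by simp
  simp_rw [norm_smul, mul_pow, integral_const_mul, Real.norm_of_nonneg (one_div_pos.2 hM').le]
  calc (1 / (M : ℝ)) ^ 2 * ∫ ω, ‖∑ m, ξ m ω‖ ^ 2 ∂P ≤ (1 / (M : ℝ)) ^ 2 * (M * v) := by gcongr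
    _ = v / M := by field_simp

theorem integral_descent_le {F : Vec d → ℝ} {L η v : ℝ} (hF : Differentiable ℝ F)
    (hL : ∀ x y, ‖gradient F x - gradient F y‖ ≤ L * ‖x - y‖) (hL0 : 0 ≤ L) (hη : 0 ≤ η)
    (hηL : L * η ≤ 1) (x h : Vec d) {ξ : Ω → Vec d} (hξ : ∫ ω, ξ ω ∂P = 0)
    (hv : ∫ ω, ‖ξ ω‖ ^ 2 ∂P ≤ v) :
    ∫ ω, F (x - η • (h + ξ ω)) ∂P ≤
      F x - η / 2 * ‖gradient F x‖ ^ 2 + η / 2 * ‖gradient F x - h‖ ^ 2 + L * η ^ 2 / 2 * v := by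
  -- The terms linear in the noise are gathered into one inner product with a fixed vector, which
  -- vanishes on integration.
  have hpt : ∀ ω, F (x - η • (h + ξ ω)) ≤ F x - η * inner ℝ (gradient F x) h +
      L * η ^ 2 / 2 * ‖h‖ ^ 2 + inner ℝ ((L * η ^ 2) • h - η • gradient F x) (ξ ω) +
      L * η ^ 2 / 2 * ‖ξ ω‖ ^ 2 := by
    intro ω
    have h1 := descent_lemma hF hL x (-(η • (h + ξ ω)))
    rw [← sub_eq_add_neg, norm_neg, norm_smul, mul_pow, norm_add_sq_real, inner_neg_right,
      inner_smul_right, inner_add_right, Real.norm_eq_abs, sq_abs] at h1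
    rw [inner_sub_left, real_inner_smul_left, real_inner_smul_left]
    refine h1.trans (le_of_eq ?_)
    ring
  have hint : ∫ ω, F (x - η • (h + ξ ω)) ∂P ≤ F x - η * inner ℝ (gradient F x) h +
      L * η ^ 2 / 2 * ‖h‖ ^ 2 + L * η ^ 2 / 2 * ∫ ω, ‖ξ ω‖ ^ 2 ∂P := by
    refine (integral_mono .of_finite .of_finite hpt).trans (le_of_eq ?_)
    rw [integral_add .of_finite .of_finite, integral_add .of_finite .of_finite,
      integral_inner .of_finite, hξ, inner_zero_right, integral_const_mul]
    simp
  have h2 : L * η ^ 2 / 2 * ∫ ω, ‖ξ ω‖ ^ 2 ∂P ≤ L * η ^ 2 / 2 * v := by gcongr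
  -- By `L * η ≤ 1` the quadratic term fits the expansion of `‖gradient F x - h‖ ^ 2`, which absorbs
  -- it together with the cross term.
  have h3 : L * η ^ 2 / 2 * ‖h‖ ^ 2 ≤ η / 2 * ‖h‖ ^ 2 := by
    gcongr
    nlinarith
  have h4 := norm_sub_sq_real (gradient F x) h
  nlinarith

theorem IsSampling.integral_globalLoss_step_le (hB : IsSampling P T B) (hM : 1 ≤ M)
    (hρ : 1 < ρ) (hb₀ : 1 ≤ b₀) (hn : ∀ m, 1 ≤ n m) (hdiff : ∀ m i, Differentiable ℝ (l m i))
    {L σ η : ℝ} (hL : 0 ≤ L)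
    (hsmooth : ∀ m w w',
      ‖gradient (avgLoss (l m)) w - gradient (avgLoss (l m)) w'‖ ≤ L * ‖w - w'‖)
    (hvar : ∀ m w,
      (1 / (n m : ℝ)) * ∑ i, ‖gradient (l m i) w - gradient (avgLoss (l m)) w‖ ^ 2 ≤ σ ^ 2)
    (hη : 0 ≤ η) (hηL : L * η ≤ 1) {t : ℕ} (ht : t < T) (x : Vec d) (y : Fin M → Vec d) :
    ∫ ω, globalLoss l
        (x - η • ((1 / (M : ℝ)) • ∑ m, batchGrad (l m) (y m) (B ω m t))) ∂P ≤
      globalLoss l x - η / 2 * ‖gradient (globalLoss l) x‖ ^ 2 +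
        η / 2 * (L ^ 2 * ((1 / (M : ℝ)) * ∑ m, ‖x - y m‖ ^ 2)) +
        L * η ^ 2 * σ ^ 2 / (2 * M) * (1 / (batchSize ρ b₀ t : ℝ)) := by
  have hb := one_le_batchSize hρ hb₀ t
  set g : Fin M → Vec d := fun m => gradient (avgLoss (l m)) (y m) with hg
  set ξ : Fin M → Ω → Vec d := fun m ω => batchGrad (l m) (y m) (B ω m t) - g m with hξ
  have hξ0 : ∀ m, ∫ ω, ξ m ω ∂P = 0 := by
    intro m
    rw [hξ, integral_sub .of_finite .of_finite,
      (hB.unif m t ht).integral_batchGrad hb (hdiff m) (y m)]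
    simp [hg]
  -- Noises of different participants are independent and centred, hence uncorrelated; this yields
  -- the factor `1 / M`.
  have hcov : ∀ i j, i ≠ j → ∫ ω, inner ℝ (ξ i ω) (ξ j ω) ∂P = 0 := by
    intro i j hij
    have hind := hB.indep.indepFun (i := (i, ⟨t, ht⟩)) (j := (j, ⟨t, ht⟩)) (by simpa using hij)
    have h := integral_comp_of_indepFun P .of_discrete .of_discrete hind fun v v' =>
      (inner ℝ (batchGrad (l i) (y i) v - g i) (batchGrad (l j) (y j) v' - g j) : ℝ)
    refine h.trans ?_
    have h0 : ∀ ω, ∫ ω', (inner ℝ (batchGrad (l i) (y i) (B ω i t) - g i)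
        (batchGrad (l j) (y j) (B ω' j t) - g j) : ℝ) ∂P = 0 := by
      intro ω
      have := integral_inner (𝕜 := ℝ) (μ := P) (f := ξ j) .of_finite
        (batchGrad (l i) (y i) (B ω i t) - g i)
      rwa [hξ0 j, inner_zero_right] at this
    simp [h0]
  have hvar' : ∀ m, ∫ ω, ‖ξ m ω‖ ^ 2 ∂P ≤ (1 / (batchSize ρ b₀ t : ℝ)) * σ ^ 2 := by
    intro m
    refine ((hB.unif m t ht).integral_norm_batchGrad_sub_sq_le hb (hn m) (hdiff m) (y m)).trans ?_
    gcongr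
    exact hvar m (y m)
  have havg0 : ∫ ω, (1 / (M : ℝ)) • ∑ m, ξ m ω ∂P = 0 := by
    rw [integral_smul, integral_finsetSum _ fun _ _ => .of_finite]
    simp [hξ0]
  have hdesc := integral_descent_le (P := P) (differentiable_globalLoss hdiff)
    (gradient_globalLoss_lipschitz hM hdiff hsmooth) hL hη hηL x ((1 / (M : ℝ)) • ∑ m, g m) havg0
    (integral_norm_avg_sq_le_of_uncorrelated hM hcov hvar')
  have heq : ∀ ω, (1 / (M : ℝ)) • ∑ m, g m + (1 / (M : ℝ)) • ∑ m, ξ m ω =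
      (1 / (M : ℝ)) • ∑ m, batchGrad (l m) (y m) (B ω m t) := by
    intro ω
    simp only [hξ, Finset.sum_sub_distrib, smul_sub]
    abel
  simp only [heq] at hdesc
  refine hdesc.trans ?_
  have hgrad := norm_gradient_globalLoss_sub_avg_sq_le hdiff hsmooth x y
  have h1 := mul_le_mul_of_nonneg_left hgrad (show 0 ≤ η / 2 by positivity)
  have h2 : L * η ^ 2 / 2 * (1 / (batchSize ρ b₀ t : ℝ) * σ ^ 2 / M) =
      L * η ^ 2 * σ ^ 2 / (2 * M) * (1 / (batchSize ρ b₀ t : ℝ)) := by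
    field_simp
  linarith

/-- The convergence bound for a deterministic initial model and a finite probability space. -/
theorem IsSampling.sum_integral_norm_gradient_sq_le (hB : IsSampling P T B) (hM : 1 ≤ M)
    (hT : 1 ≤ T) (hρ : 1 < ρ) (hb₀ : 1 ≤ b₀) (hn : ∀ m, 1 ≤ n m)
    {k : Fin M → ℕ} (hk : ∀ m, 1 ≤ k m ∧ k m ≤ d) {H : ℕ} (hH : 1 ≤ H)
    (hdiff : ∀ m i, Differentiable ℝ (l m i)) {L σ G η Fstar : ℝ} (hL : 0 ≤ L)
    (hsmooth : ∀ m w w',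
      ‖gradient (avgLoss (l m)) w - gradient (avgLoss (l m)) w'‖ ≤ L * ‖w - w'‖)
    (hFstar : ∀ w, Fstar ≤ globalLoss l w)
    (hvar : ∀ m w,
      (1 / (n m : ℝ)) * ∑ i, ‖gradient (l m i) w - gradient (avgLoss (l m)) w‖ ^ 2 ≤ σ ^ 2)
    (hmom : ∀ m, ∀ t < T, ∀ w, ∫ ω, ‖batchGrad (l m) w (B ω m t)‖ ^ 2 ∂P ≤ G ^ 2)
    (hη : 0 < η) (hηL : L * η ≤ 1) (w : Vec d) :
    (1 / ((M : ℝ) * T)) * ∑ t ∈ Finset.range T, ∑ m,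
        ∫ ω, ‖gradient (globalLoss l) ((run l k H (fun _ => η) w (B ω) t).loc m)‖ ^ 2 ∂P ≤
      4 * (globalLoss l w - Fstar) / (η * T) +
        4 * ρ * L * η * σ ^ 2 / ((ρ - 1) * b₀ * M * T) +
        8 * L ^ 2 * (4 * rmsSparsity d k ^ 2 + 1) * (η ^ 2 * G ^ 2 * H ^ 2) := by
  have hM' : (0 : ℝ) < M := by exact_mod_cast hM
  have hT' : (0 : ℝ) < T := by exact_mod_cast hT
  set S : ℕ → Ω → State d M := fun t ω => run l k H (fun _ => η) w (B ω) t with hS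
  set F := globalLoss l with hF
  set D := 2 * (4 * rmsSparsity d k ^ 2 + 1) * (η ^ 2 * G ^ 2 * H ^ 2) with hD
  set A : ℕ → ℝ := fun t => ∫ ω, ‖gradient F (S t ω).virtual‖ ^ 2 ∂P with hA
  set β : ℕ → ℝ := fun t => 1 / (batchSize ρ b₀ t : ℝ) with hβ
  have hdev : ∀ t < T,
      ∫ ω, (1 / (M : ℝ)) * ∑ m, ‖(S t ω).virtual - (S t ω).loc m‖ ^ 2 ∂P ≤ D :=
    fun t ht => hB.integral_avg_norm_virtual_sub_loc_sq_le hmom hM hk hH hη.le w ht.le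
  have hstep : ∀ t < T, ∫ ω, F (S (t + 1) ω).virtual ∂P ≤ ∫ ω, F (S t ω).virtual ∂P -
      η / 2 * A t + η / 2 * (L ^ 2 * D) + L * η ^ 2 * σ ^ 2 / (2 * M) * β t := by
    intro t ht
    have h1 : ∀ ω, (S (t + 1) ω).virtual = (S t ω).virtual -
        η • ((1 / (M : ℝ)) • ∑ m, batchGrad (l m) ((S t ω).loc m) (B ω m t)) :=
      fun ω => virtual_step hM l k η (H ∣ t + 1) (fun m => B ω m t) (S t ω)
    simp_rw [h1]
    rw [hB.integral_run_batch k H (fun _ => η) w ht fun s v =>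
      F (s.virtual - η • ((1 / (M : ℝ)) • ∑ m, batchGrad (l m) (s.loc m) (v m)))]
    calc _ ≤ ∫ ω, (F (S t ω).virtual - η / 2 * ‖gradient F (S t ω).virtual‖ ^ 2 +
          η / 2 * (L ^ 2 * ((1 / (M : ℝ)) * ∑ m, ‖(S t ω).virtual - (S t ω).loc m‖ ^ 2)) +
          L * η ^ 2 * σ ^ 2 / (2 * M) * β t) ∂P :=
          integral_mono .of_finite .of_finite fun ω =>
            hB.integral_globalLoss_step_le hM hρ hb₀ hn hdiff hL hsmooth hvar hη.le hηL ht
              (S t ω).virtual (S t ω).loc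
      _ = ∫ ω, F (S t ω).virtual ∂P - η / 2 * A t + η / 2 * (L ^ 2 *
            ∫ ω, (1 / (M : ℝ)) * ∑ m, ‖(S t ω).virtual - (S t ω).loc m‖ ^ 2 ∂P) +
          L * η ^ 2 * σ ^ 2 / (2 * M) * β t := by
          rw [integral_add .of_finite .of_finite, integral_add .of_finite .of_finite,
            integral_sub .of_finite .of_finite, integral_const_mul, integral_const_mul,
            integral_const_mul (L ^ 2), integral_const]
          simp [hA]
      _ ≤ _ := by
          gcongr
          exact hdev t ht
  have htel : ∀ j ≤ T, η / 2 * ∑ t ∈ Finset.range j, A t ≤ F w - ∫ ω, F (S j ω).virtual ∂P +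
      j * (η / 2 * (L ^ 2 * D)) +
      L * η ^ 2 * σ ^ 2 / (2 * M) * ∑ t ∈ Finset.range j, β t := by
    intro j
    induction j with
    | zero =>
      intro _
      have h0 : ∀ ω, (S 0 ω).virtual = w := by
        intro ω
        simp only [hS, run, State.virtual, avg_const hM]
        simp
      simp [h0]
    | succ j ih =>
      intro hj
      have h1 := ih (by omega)
      have h2 := hstep j (by omega)
      rw [Finset.sum_range_succ, Finset.sum_range_succ]
      push_cast
      linarith
  have hlow : Fstar ≤ ∫ ω, F (S T ω).virtual ∂P := by
    calc Fstar = ∫ _ω, Fstar ∂P := by simp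
      _ ≤ _ := integral_mono .of_finite .of_finite fun ω => hFstar _
  -- Descent controls the gradient at the virtual iterate only; passing to the local models costs a
  -- factor `2` and one more deviation term.
  have hloc : ∀ t < T, (1 / (M : ℝ)) * ∑ m, ∫ ω, ‖gradient F ((S t ω).loc m)‖ ^ 2 ∂P ≤
      2 * A t + 2 * (L ^ 2 * D) := by
    intro t ht
    have hpt : ∀ ω, (1 / (M : ℝ)) * ∑ m, ‖gradient F ((S t ω).loc m)‖ ^ 2 ≤
        2 * ‖gradient F (S t ω).virtual‖ ^ 2 +
          2 * (L ^ 2 * ((1 / (M : ℝ)) * ∑ m, ‖(S t ω).virtual - (S t ω).loc m‖ ^ 2)) := by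
      intro ω
      have h1 : ∀ m, ‖gradient F ((S t ω).loc m)‖ ^ 2 ≤ 2 * ‖gradient F (S t ω).virtual‖ ^ 2 +
          2 * L ^ 2 * ‖(S t ω).virtual - (S t ω).loc m‖ ^ 2 := by
        intro m
        have h2 := norm_add_sq_le_two (gradient F (S t ω).virtual)
          (gradient F ((S t ω).loc m) - gradient F (S t ω).virtual)
        rw [add_sub_cancel] at h2
        have h3 := pow_le_pow_left₀ (norm_nonneg _)
          (gradient_globalLoss_lipschitz hM hdiff hsmooth ((S t ω).loc m) (S t ω).virtual) 2
        rw [mul_pow, norm_sub_rev ((S t ω).loc m)] at h3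
        linarith
      calc _ ≤ (1 / (M : ℝ)) * ∑ m, (2 * ‖gradient F (S t ω).virtual‖ ^ 2 +
            2 * L ^ 2 * ‖(S t ω).virtual - (S t ω).loc m‖ ^ 2) := by
            gcongr with m
            exact h1 m
        _ = _ := by
            have := avg_const hM (2 * ‖gradient F (S t ω).virtual‖ ^ 2)
            rw [smul_eq_mul] at this
            rw [Finset.sum_add_distrib, mul_add, this, ← Finset.mul_sum]
            ring
    calc _ = ∫ ω, (1 / (M : ℝ)) * ∑ m, ‖gradient F ((S t ω).loc m)‖ ^ 2 ∂P := by
          rw [integral_const_mul, integral_finsetSum _ fun _ _ => .of_finite]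
      _ ≤ _ := integral_mono .of_finite .of_finite hpt
      _ = 2 * A t + 2 * (L ^ 2 *
            ∫ ω, (1 / (M : ℝ)) * ∑ m, ‖(S t ω).virtual - (S t ω).loc m‖ ^ 2 ∂P) := by
          rw [integral_add .of_finite .of_finite, integral_const_mul, integral_const_mul,
            integral_const_mul (L ^ 2)]
      _ ≤ _ := by
          gcongr
          exact hdev t ht
  have hsum := Finset.sum_le_sum fun t ht => hloc t (Finset.mem_range.1 ht)
  rw [← Finset.mul_sum, Finset.sum_add_distrib, ← Finset.mul_sum, Finset.sum_const,
    Finset.card_range, nsmul_eq_mul] at hsum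
  have hβsum := sum_inv_batchSize_le hρ hb₀ T
  have hmain := htel T le_rfl
  set Q := ∑ t ∈ Finset.range T, A t
  set R := ∑ t ∈ Finset.range T, ∑ m, ∫ ω, ‖gradient F ((S t ω).loc m)‖ ^ 2 ∂P
  have h1 : η / 2 * Q ≤ F w - Fstar + T * (η / 2 * (L ^ 2 * D)) +
      L * η ^ 2 * σ ^ 2 / (2 * M) * (2 * ρ / ((ρ - 1) * b₀)) := by
    have : L * η ^ 2 * σ ^ 2 / (2 * M) * ∑ t ∈ Finset.range T, β t ≤
        L * η ^ 2 * σ ^ 2 / (2 * M) * (2 * ρ / ((ρ - 1) * b₀)) := by gcongr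
    linarith
  have h2 : Q ≤ 2 / η * (F w - Fstar + T * (η / 2 * (L ^ 2 * D)) +
      L * η ^ 2 * σ ^ 2 / (2 * M) * (2 * ρ / ((ρ - 1) * b₀))) := by
    have := mul_le_mul_of_nonneg_left h1 (show 0 ≤ 2 / η by positivity)
    refine le_trans (le_of_eq ?_) this
    field_simp
  have hρ1 : 0 < ρ - 1 := by linarith
  have hb : (0 : ℝ) < b₀ := by exact_mod_cast hb₀
  -- The deviation bound `D` enters through the descent and through the passage to the local models,
  -- each contributing `2 * L ^ 2 * D`.
  calc (1 / ((M : ℝ) * T)) * R = 1 / T * (1 / (M : ℝ) * R) := by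
        field_simp
    _ ≤ 1 / T * (2 * Q + T * (2 * (L ^ 2 * D))) := by gcongr
    _ ≤ 1 / T * (2 * (2 / η * (F w - Fstar + T * (η / 2 * (L ^ 2 * D)) +
          L * η ^ 2 * σ ^ 2 / (2 * M) * (2 * ρ / ((ρ - 1) * b₀)))) +
          T * (2 * (L ^ 2 * D))) := by gcongr
    _ = _ := by
        rw [hD]
        field_simp
        ring

end Core

end

section

/-! ### Measurability of the run -/

variable {d M : ℕ} {n : Fin M → ℕ} {ρ : ℝ} {b₀ : ℕ}

theorem measurable_gradient (f : Vec d → ℝ) : Measurable (gradient f) :=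
  (InnerProductSpace.toDual ℝ (Vec d)).symm.continuous.measurable.comp (measurable_fderiv ℝ f)

theorem measurable_run (l : ∀ m, Fin (n m) → Vec d → ℝ) (k : Fin M → ℕ) (H : ℕ) (η : ℕ → ℝ)
    (B : Batches n ρ b₀) : ∀ t, Measurable (fun w => (run l k H η w B t).glob) ∧
      (∀ m, Measurable fun w => (run l k H η w B t).loc m) ∧
      ∀ m, Measurable fun w => (run l k H η w B t).err m
  | 0 => ⟨measurable_id, fun _ => measurable_id, fun _ => measurable_const⟩
  | t + 1 => by
    obtain ⟨hglob, hloc, herr⟩ := measurable_run l k H η B t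
    have hhalf : ∀ m, Measurable fun w => (run l k H η w B t).loc m -
        η t • batchGrad (l m) ((run l k H η w B t).loc m) (B m t) := fun m =>
      (hloc m).sub (((measurable_gradient _).comp (hloc m)).const_smul (η t))
    have hu := fun m => ((herr m).add hglob).sub (hhalf m)
    have hg := fun m => (measurable_topK (k m)).comp (hu m)
    have hw := hglob.sub ((Finset.measurable_sum Finset.univ fun m _ => hg m).const_smul
      (1 / (M : ℝ)))
    simp only [run, step]
    split_ifs
    · exact ⟨hw, fun _ => hw, fun m => (hu m).sub (hg m)⟩
    · exact ⟨hglob, hhalf, herr⟩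

/-! ### Reduction to finitely many mini-batches -/

/-- The mini-batches used before time `T`. -/
abbrev FinBatches (n : Fin M → ℕ) (ρ : ℝ) (b₀ T : ℕ) : Type :=
  ∀ p : Fin M × Fin T, Fin (batchSize ρ b₀ p.2) → Fin (n p.1)

/-- Forget the mini-batches from time `T` on. -/
def Batches.restrict (B : Batches n ρ b₀) (T : ℕ) : FinBatches n ρ b₀ T :=
  fun p => B p.1 p.2

/-- Continue mini-batches given before time `T` arbitrarily. -/
def FinBatches.extend {T : ℕ} (hn : ∀ m, 1 ≤ n m) (v : FinBatches n ρ b₀ T) : Batches n ρ b₀ :=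
  fun m t => if h : t < T then v (m, ⟨t, h⟩) else fun _ => ⟨0, hn m⟩

theorem extend_restrict_apply {T : ℕ} (hn : ∀ m, 1 ≤ n m) (B : Batches n ρ b₀) (m : Fin M) {t : ℕ}
    (ht : t < T) : (B.restrict T).extend hn m t = B m t := by
  simp [FinBatches.extend, Batches.restrict, ht]

section Restrict

variable {Ω : Type*} [MeasurableSpace Ω] {P : Measure Ω} {T : ℕ} {B : Ω → Batches n ρ b₀}

theorem IsSampling.measurable_restrict (hB : IsSampling P T B) :
    Measurable fun ω => (B ω).restrict T :=
  measurable_pi_lambda _ fun p => (hB.unif p.1 p.2 p.2.2).1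

/-- Transports the sampling assumptions to the law of the batches on the finite space `FinBatches`,
where the bound for a fixed initial model applies. -/
theorem IsSampling.map_restrict [IsProbabilityMeasure P] (hB : IsSampling P T B) (hn : ∀ m, 1 ≤ n m) :
    IsSampling (P.map fun ω => (B ω).restrict T) T (FinBatches.extend hn) where
  unif m t ht := by
    have hmap : ∀ x, (P.map fun ω => (B ω).restrict T).real
        ((fun v : FinBatches n ρ b₀ T => v.extend hn m t) ⁻¹' {x}) =
          P.real ((fun ω => B ω m t) ⁻¹' {x}) := by
      intro x
      rw [map_measureReal_apply hB.measurable_restrict .of_discrete]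
      congr 1
      ext ω
      simp [extend_restrict_apply hn (B ω) m ht]
    refine ⟨.of_discrete, ?_⟩
    simp_rw [hmap]
    exact (hB.unif m t ht).2
  indep := by
    have := Measure.isProbabilityMeasure_map (μ := P) hB.measurable_restrict.aemeasurable
    have hmeas : ∀ p : Fin M × Fin T, Measurable fun ω => B ω p.1 (p.2 : ℕ) :=
      fun p => (hB.unif p.1 p.2 p.2.2).1
    have hcomp : ∀ (p : Fin M × Fin T) ω, ((B ω).restrict T).extend hn p.1 (p.2 : ℕ) =
        B ω p.1 p.2 := fun p ω => extend_restrict_apply hn (B ω) p.1 p.2.2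
    rw [iIndepFun_iff_map_fun_eq_pi_map fun _ => Measurable.of_discrete.aemeasurable,
      Measure.map_map .of_discrete hB.measurable_restrict]
    have h := (iIndepFun_iff_map_fun_eq_pi_map fun p => (hmeas p).aemeasurable).1 hB.indep
    convert h using 2
    · ext ω : 1
      exact funext fun p => hcomp p ω
    · ext p : 1
      rw [Measure.map_map .of_discrete hB.measurable_restrict]
      congr 1
      ext ω : 1
      exact hcomp p ω

end Restrict

/-! ### Averaging over the random initial model -/

section RandomStart

variable {Ω : Type*} [MeasurableSpace Ω] {P : Measure Ω} [IsProbabilityMeasure P]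
  {α β ι : Type*} [MeasurableSpace α] [MeasurableSpace β] [Finite β] [MeasurableSingletonClass β]
  {X : Ω → α} {Y : Ω → β}

/-- If `X` and `Y` are independent, `Y` is finitely valued, and the expectation over `Y` of a sum
of nonnegative functions is bounded by an integrable function of `X`, then the summands are
integrable, and the bound can be averaged over `X`. -/
theorem integrable_and_sum_integral_le_of_indepFun (hX : Measurable X) (hY : Measurable Y)
    (hXY : IndepFun X Y P) (s : Finset ι) {ψ : ι → α → β → ℝ}
    (hψ : ∀ i ∈ s, ∀ y, Measurable fun x => ψ i x y) (hψ0 : ∀ i ∈ s, ∀ x y, 0 ≤ ψ i x y)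
    {c : α → ℝ} (hc : Measurable c) (hcX : Integrable (fun ω => c (X ω)) P)
    (hle : ∀ x, ∑ i ∈ s, ∫ y, ψ i x y ∂(P.map Y) ≤ c x) :
    (∀ i ∈ s, Integrable (fun ω => ψ i (X ω) (Y ω)) P) ∧
      ∑ i ∈ s, ∫ ω, ψ i (X ω) (Y ω) ∂P ≤ ∫ ω, c (X ω) ∂P := by
  have : IsProbabilityMeasure (P.map X) := Measure.isProbabilityMeasure_map hX.aemeasurable
  have : IsProbabilityMeasure (P.map Y) := Measure.isProbabilityMeasure_map hY.aemeasurable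
  have hlaw := (indepFun_iff_map_prod_eq_prod_map_map hX.aemeasurable hY.aemeasurable).1 hXY
  have hXY' : Measurable fun ω => (X ω, Y ω) := hX.prodMk hY
  have hmeas : ∀ i ∈ s, Measurable fun z : α × β => ψ i z.1 z.2 := fun i hi =>
    measurable_from_prod_countable_left (f := fun z : α × β => ψ i z.1 z.2) fun y => hψ i hi y
  have hc' : Integrable c (P.map X) :=
    (integrable_map_measure hc.aestronglyMeasurable hX.aemeasurable).2 hcX
  have hint0 : ∀ i ∈ s, ∀ x, 0 ≤ ∫ y, ψ i x y ∂(P.map Y) := fun i hi x =>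
    integral_nonneg fun y => hψ0 i hi x y
  have hprod : ∀ i ∈ s,
      Integrable (fun z : α × β => ψ i z.1 z.2) ((P.map X).prod (P.map Y)) := by
    intro i hi
    have hsm := (hmeas i hi).aestronglyMeasurable (μ := (P.map X).prod (P.map Y))
    refine (integrable_prod_iff hsm).2 ⟨.of_forall fun _ => .of_finite, ?_⟩
    -- Each summand is nonnegative, so its inner integral is dominated by the whole sum and hence by
    -- `c`.
    refine hc'.mono' hsm.norm.integral_prod_right' (.of_forall fun x => ?_)
    have hnorm : ∀ y, ‖ψ i x y‖ = ψ i x y := fun y => Real.norm_of_nonneg (hψ0 i hi x y)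
    simp only [hnorm]
    rw [Real.norm_of_nonneg (hint0 i hi x)]
    exact (Finset.single_le_sum (f := fun i => ∫ y, ψ i x y ∂(P.map Y))
      (fun j hj => hint0 j hj x) hi).trans (hle x)
  have hmap : ∀ i ∈ s, ∫ ω, ψ i (X ω) (Y ω) ∂P = ∫ x, ∫ y, ψ i x y ∂(P.map Y) ∂(P.map X) := by
    intro i hi
    rw [← integral_prod _ (hprod i hi), ← hlaw,
      integral_map hXY'.aemeasurable (hmeas i hi).aestronglyMeasurable]
  refine ⟨fun i hi => ?_, ?_⟩
  · have h := hprod i hi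
    rw [← hlaw] at h
    exact (integrable_map_measure (hmeas i hi).aestronglyMeasurable hXY'.aemeasurable).1 h
  · rw [Finset.sum_congr rfl hmap, ← integral_finsetSum _ fun i hi => (hprod i hi).integral_prod_left,
      ← integral_map (f := c) hX.aemeasurable hc.aestronglyMeasurable]
    exact integral_mono (integrable_finsetSum _ fun i hi => (hprod i hi).integral_prod_left) hc' hle

end RandomStart

/-! ### The law of a uniformly drawn local iterate -/

section Law

variable {Ω : Type*} [MeasurableSpace Ω] {P : Measure Ω} {W : ℕ → Fin M → Ω → Vec d} {T : ℕ}
  {f : Vec d → ℝ}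

theorem integrable_sampledIterateLaw (hM : 1 ≤ M) (hT : 1 ≤ T) (hf : Measurable f)
    (hW : ∀ t < T, ∀ m, Measurable (W t m) ∧ Integrable (fun ω => f (W t m ω)) P) :
    Integrable f (sampledIterateLaw P W T) := by
  refine Integrable.smul_measure ?_ (ENNReal.inv_ne_top.2 (mul_ne_zero ?_ ?_))
  · refine integrable_finsetSum_measure.2 fun t ht => integrable_finsetSum_measure.2 fun m _ => ?_
    have h := hW t (Finset.mem_range.1 ht) m
    exact (integrable_map_measure hf.aestronglyMeasurable h.1.aemeasurable).2 h.2
  all_goals exact Nat.cast_ne_zero.2 (by omega)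

theorem integral_sampledIterateLaw (hf : Measurable f)
    (hW : ∀ t < T, ∀ m, Measurable (W t m) ∧ Integrable (fun ω => f (W t m ω)) P) :
    ∫ z, f z ∂(sampledIterateLaw P W T) =
      (1 / ((M : ℝ) * (T : ℝ))) * ∑ t ∈ Finset.range T, ∑ m, ∫ ω, f (W t m ω) ∂P := by
  have hint : ∀ t < T, ∀ m, Integrable f (P.map (W t m)) := fun t ht m =>
    (integrable_map_measure hf.aestronglyMeasurable (hW t ht m).1.aemeasurable).2 (hW t ht m).2
  rw [sampledIterateLaw, integral_smul_measure, integral_finsetSum_measure fun t ht =>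
    integrable_finsetSum_measure.2 fun m _ => hint t (Finset.mem_range.1 ht) m]
  simp only [ENNReal.toReal_inv, ENNReal.toReal_mul, ENNReal.toReal_natCast, smul_eq_mul, one_div]
  congr 1
  refine Finset.sum_congr rfl fun t ht => ?_
  rw [integral_finsetSum_measure fun m _ => hint t (Finset.mem_range.1 ht) m]
  exact Finset.sum_congr rfl fun m _ => integral_map
    (hW t (Finset.mem_range.1 ht) m).1.aemeasurable hf.aestronglyMeasurable

end Law

/-! ### The step size `θ √M / √T` -/

theorem bound_of_stepSize_le {M T b₀ : ℕ} {ρ θ L σ G Δ r h : ℝ} (hM : 1 ≤ M) (hT : 1 ≤ T)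
    (hb₀ : 1 ≤ b₀) (hρ : 1 < ρ) (hθ : 0 < θ) (hL : 0 < L) :
    4 * Δ / (θ * √(M : ℝ) / √(T : ℝ) * T) +
        4 * ρ * L * (θ * √(M : ℝ) / √(T : ℝ)) * σ ^ 2 / ((ρ - 1) * b₀ * M * T) +
        8 * L ^ 2 * (4 * r ^ 2 + 1) * ((θ * √(M : ℝ) / √(T : ℝ)) ^ 2 * G ^ 2 * h ^ 2) ≤
      4 * Δ / (θ * √((M : ℝ) * (T : ℝ))) +
        8 * ρ * θ * L * σ ^ 2 / ((ρ - 1) * (b₀ : ℝ) * √(M : ℝ) * (T : ℝ) ^ (3 / 2 : ℝ)) +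
        (4 * r ^ 2 + 1) * (8 * (M : ℝ) * θ ^ 2 * L ^ 2 * G ^ 2 * h ^ 2 / (T : ℝ)) := by
  have hM' : (0 : ℝ) < M := by exact_mod_cast hM
  have hT' : (0 : ℝ) < T := by exact_mod_cast hT
  have hb : (0 : ℝ) < b₀ := by exact_mod_cast hb₀
  have hρ1 : 0 < ρ - 1 := by linarith
  have hρ0 : 0 < ρ := by linarith
  have hpow : (T : ℝ) ^ (3 / 2 : ℝ) = T * √(T : ℝ) := by
    rw [show (3 / 2 : ℝ) = 1 + 1 / 2 by norm_num, Real.rpow_add hT', Real.rpow_one,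
      Real.sqrt_eq_rpow]
  rw [hpow, Real.sqrt_mul hM'.le]
  set m := √(M : ℝ) with hm
  set τ := √(T : ℝ) with hτ
  have hm0 : 0 < m := Real.sqrt_pos.2 hM'
  have hτ0 : 0 < τ := Real.sqrt_pos.2 hT'
  have hmM : (M : ℝ) = m ^ 2 := (Real.sq_sqrt hM'.le).symm
  have hτT : (T : ℝ) = τ ^ 2 := (Real.sq_sqrt hT'.le).symm
  rw [hmM, hτT]
  have h1 : 4 * Δ / (θ * m / τ * τ ^ 2) = 4 * Δ / (θ * (m * τ)) := by
    congr 1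
    field_simp
  -- The noise term obtained is half of the one claimed; the other two terms agree exactly.
  have h2 : 8 * ρ * θ * L * σ ^ 2 / ((ρ - 1) * b₀ * m * (τ ^ 2 * τ)) =
      2 * (4 * ρ * L * (θ * m / τ) * σ ^ 2 / ((ρ - 1) * b₀ * m ^ 2 * τ ^ 2)) := by
    field_simp
    ring
  have h3 : 8 * L ^ 2 * (4 * r ^ 2 + 1) * ((θ * m / τ) ^ 2 * G ^ 2 * h ^ 2) =
      (4 * r ^ 2 + 1) * (8 * m ^ 2 * θ ^ 2 * L ^ 2 * G ^ 2 * h ^ 2 / τ ^ 2) := by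
    field_simp
  have h4 : 0 ≤ 4 * ρ * L * (θ * m / τ) * σ ^ 2 / ((ρ - 1) * b₀ * m ^ 2 * τ ^ 2) := by positivity
  rw [h1, h2, h3]
  linarith

end

end FTLSGD

end

/-! ### The main theorem -/

open FTLSGD in
theorem theorem1
    -- dimension, participants, local steps, iterations, sizes of the data sets, sparsification
    {d M H T b₀ : ℕ} {n k : Fin M → ℕ} {ρ θ L σ G Fstar : ℝ}
    (hM : 1 ≤ M) (hH : 1 ≤ H) (hT : 1 ≤ T) (hb₀ : 1 ≤ b₀) (hρ : 1 < ρ)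
    (hn : ∀ m, 1 ≤ n m) (hk : ∀ m, 1 ≤ k m ∧ k m ≤ d)
    -- the sample losses; the local losses are `L`-smooth; the optimal value is finite
    (l : ∀ m, Fin (n m) → Vec d → ℝ)
    (hdiff : ∀ m i, Differentiable ℝ (l m i))
    (hL : 0 < L)
    (hsmooth : ∀ m w w',
      ‖gradient (avgLoss (l m)) w - gradient (avgLoss (l m)) w'‖ ≤ L * ‖w - w'‖)
    (hFstar : IsGLB (Set.range (globalLoss l)) Fstar)
    -- the random initial model and the independent uniform mini-batches
    {Ω : Type*} [MeasurableSpace Ω] (P : Measure Ω) [IsProbabilityMeasure P]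
    (w₀ : Ω → Vec d) (hw₀ : Measurable w₀)
    (hFw₀ : Integrable (fun ω => globalLoss l (w₀ ω)) P)
    (B : Ω → Batches n ρ b₀)
    (hunif : ∀ m, ∀ t < T, IsUniformBatch P (fun ω => B ω m t))
    (hindep : iIndepFun (fun (p : Fin M × Fin T) ω => B ω p.1 (p.2 : ℕ)) P)
    (hindep₀ : IndepFun w₀ (fun ω (p : Fin M × Fin T) => B ω p.1 (p.2 : ℕ)) P)
    -- variance of a single uniform sample, second moment of the mini-batch gradients
    (hvar : ∀ m w,
      (1 / (n m : ℝ)) * ∑ i, ‖gradient (l m i) w - gradient (avgLoss (l m)) w‖ ^ 2 ≤ σ ^ 2)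
    (hmom : ∀ m, ∀ t < T, ∀ w, ∫ ω, ‖batchGrad (l m) w (B ω m t)‖ ^ 2 ∂P ≤ G ^ 2)
    -- the step size `η = θ √M / √T`
    (hθ : 0 < θ) (hη : θ * √(M : ℝ) / √(T : ℝ) ≤ 1 / (2 * L)) :
    let W : ℕ → Fin M → Ω → Vec d := fun t m ω =>
      (run l k H (fun _ => θ * √(M : ℝ) / √(T : ℝ)) (w₀ ω) (B ω) t).loc m
    (∀ t < T, ∀ m, Measurable (W t m) ∧
      Integrable (fun ω => ‖gradient (globalLoss l) (W t m ω)‖ ^ 2) P) ∧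
    Integrable (fun z => ‖gradient (globalLoss l) z‖ ^ 2) (sampledIterateLaw P W T) ∧
    ∫ z, ‖gradient (globalLoss l) z‖ ^ 2 ∂(sampledIterateLaw P W T) =
      (1 / ((M : ℝ) * (T : ℝ))) * ∑ t ∈ Finset.range T, ∑ m,
        ∫ ω, ‖gradient (globalLoss l) (W t m ω)‖ ^ 2 ∂P ∧
    ∫ z, ‖gradient (globalLoss l) z‖ ^ 2 ∂(sampledIterateLaw P W T) ≤
      4 * ((∫ ω, globalLoss l (w₀ ω) ∂P) - Fstar) / (θ * √((M : ℝ) * (T : ℝ))) +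
      8 * ρ * θ * L * σ ^ 2 / ((ρ - 1) * (b₀ : ℝ) * √(M : ℝ) * (T : ℝ) ^ (3 / 2 : ℝ)) +
      (4 * rmsSparsity d k ^ 2 + 1) *
        (8 * (M : ℝ) * θ ^ 2 * L ^ 2 * G ^ 2 * (H : ℝ) ^ 2 / (T : ℝ)) := by
  intro W
  have hM' : (0 : ℝ) < M := by exact_mod_cast hM
  have hT' : (0 : ℝ) < T := by exact_mod_cast hT
  set η : ℝ := θ * √(M : ℝ) / √(T : ℝ) with hηdef
  have hη0 : 0 < η := by positivity
  have hηL : L * η ≤ 1 := by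
    have h := mul_le_mul_of_nonneg_left hη hL.le
    have h' : L * (1 / (2 * L)) = 1 / 2 := by field_simp
    linarith
  have hB : IsSampling P T B := ⟨hunif, hindep⟩
  set Y : Ω → FinBatches n ρ b₀ T := fun ω => (B ω).restrict T with hYdef
  have hY : Measurable Y := hB.measurable_restrict
  have : IsProbabilityMeasure (P.map Y) := Measure.isProbabilityMeasure_map hY.aemeasurable
  have hfin := hB.map_restrict hn
  have hmom' : ∀ m, ∀ t < T, ∀ w,
      ∫ v, ‖batchGrad (l m) w (FinBatches.extend hn v m t)‖ ^ 2 ∂(P.map Y) ≤ G ^ 2 := by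
    intro m t ht w
    rw [integral_map hY.aemeasurable StronglyMeasurable.of_discrete.aestronglyMeasurable]
    simpa only [hYdef, extend_restrict_apply hn _ m ht] using hmom m t ht w
  have hgmeas : Measurable fun z => ‖gradient (globalLoss l) z‖ ^ 2 :=
    (measurable_gradient _).norm.pow_const 2
  have hFmeas : Measurable (globalLoss l) := (differentiable_globalLoss hdiff).continuous.measurable
  -- Iterates before time `T` do not see later batches, so they are functions of the initial model
  -- and the finitely valued `Y`.
  have hWeq : ∀ t < T, ∀ m ω,
      W t m ω = (run l k H (fun _ => η) (w₀ ω) ((Y ω).extend hn) t).loc m := by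
    intro t ht m ω
    simp only [W]
    rw [run_congr l k H (fun _ => η) (w₀ ω) t fun m s hs =>
      (extend_restrict_apply hn (B ω) m (hs.trans ht)).symm]
  have hWmeas : ∀ t < T, ∀ m, Measurable (W t m) := by
    intro t ht m
    have h : Measurable fun z : Vec d × FinBatches n ρ b₀ T =>
        (run l k H (fun _ => η) z.1 (z.2.extend hn) t).loc m :=
      measurable_from_prod_countable_left fun v =>
        (measurable_run l k H (fun _ => η) (v.extend hn) t).2.1 m
    rw [funext (hWeq t ht m)]
    exact h.comp (hw₀.prodMk hY)
  set C := 4 * ρ * L * η * σ ^ 2 / ((ρ - 1) * b₀ * M * T) +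
    8 * L ^ 2 * (4 * rmsSparsity d k ^ 2 + 1) * (η ^ 2 * G ^ 2 * H ^ 2) with hC
  -- The bound for a fixed initial model, multiplied by `M * T`. It is affine in `globalLoss l w`,
  -- so it is integrable at `w₀`, and its expectation involves only that of the initial loss.
  set c : Vec d → ℝ := fun w =>
    M * T * (4 * (globalLoss l w - Fstar) / (η * T) + C) with hc
  have hgap : Integrable (fun ω => 4 * (globalLoss l (w₀ ω) - Fstar) / (η * T)) P :=
    ((hFw₀.sub (integrable_const _)).const_mul 4).div_const _
  have hcint : Integrable (fun ω => c (w₀ ω)) P := (hgap.add (integrable_const _)).const_mul _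
  have hcmeas : Measurable c :=
    ((((hFmeas.sub measurable_const).const_mul 4).div_const _).add measurable_const).const_mul _
  have hcore : ∀ w, ∑ p ∈ Finset.range T ×ˢ (Finset.univ : Finset (Fin M)), ∫ v,
      ‖gradient (globalLoss l) ((run l k H (fun _ => η) w (FinBatches.extend hn v) p.1).loc p.2)‖ ^ 2
        ∂(P.map Y) ≤ c w := by
    intro w
    rw [Finset.sum_product]
    have h := hfin.sum_integral_norm_gradient_sq_le hM hT hρ hb₀ hn hk hH hdiff hL.le hsmooth
      (fun w => hFstar.1 ⟨w, rfl⟩) hvar hmom' hη0 hηL w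
    rw [one_div_mul_eq_div, div_le_iff₀ (by positivity)] at h
    refine h.trans (le_of_eq ?_)
    simp only [hc, hC]
    ring
  obtain ⟨hint, hsum⟩ := integrable_and_sum_integral_le_of_indepFun hw₀ hY hindep₀
    (Finset.range T ×ˢ (Finset.univ : Finset (Fin M)))
    (fun p _ v => hgmeas.comp ((measurable_run l k H (fun _ => η) (v.extend hn) p.1).2.1 p.2))
    (fun _ _ _ _ => sq_nonneg _) hcmeas hcint hcore
  have hW : ∀ t < T, ∀ m, Measurable (W t m) ∧
      Integrable (fun ω => ‖gradient (globalLoss l) (W t m ω)‖ ^ 2) P := by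
    refine fun t ht m => ⟨hWmeas t ht m, ?_⟩
    simp only [hWeq t ht m]
    exact hint (t, m) (by simpa using ht)
  have hlaw := integral_sampledIterateLaw hgmeas hW
  refine ⟨hW, integrable_sampledIterateLaw hM hT hgmeas hW, hlaw, ?_⟩
  have hsum' : ∑ t ∈ Finset.range T, ∑ m, ∫ ω, ‖gradient (globalLoss l) (W t m ω)‖ ^ 2 ∂P ≤
      ∫ ω, c (w₀ ω) ∂P := by
    refine le_trans (le_of_eq ?_) hsum
    rw [Finset.sum_product]
    refine Finset.sum_congr rfl fun t ht => Finset.sum_congr rfl fun m _ => ?_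
    simp only [hWeq t (Finset.mem_range.1 ht) m, Function.comp_apply]
  have hcval : ∫ ω, c (w₀ ω) ∂P =
      M * T * (4 * ((∫ ω, globalLoss l (w₀ ω) ∂P) - Fstar) / (η * T) + C) := by
    simp only [hc]
    rw [integral_const_mul, integral_add hgap (integrable_const _), integral_div, integral_const_mul, integral_sub hFw₀ (integrable_const _)]
    simp
  rw [hlaw]
  calc _ ≤ (1 / ((M : ℝ) * T)) *
        (M * T * (4 * ((∫ ω, globalLoss l (w₀ ω) ∂P) - Fstar) / (η * T) + C)) := by
        gcongr
        exact hsum'.trans hcval.le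
    _ = 4 * ((∫ ω, globalLoss l (w₀ ω) ∂P) - Fstar) / (η * T) + C := by
        field_simp
    _ ≤ _ := by
        rw [hC, ← add_assoc]
        exact bound_of_stepSize_le hM hT hb₀ hρ hθ hL
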